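/- Let $d\in\mathbb N$, $p\ge 1$, $T>0$. Words are finite sequences of letters in $\{0,1,\dots,d\}$, where the letter $0$ stands for time; a weighted word is a finite real linear combination of words. An element $x$ of the extended tensor algebra $T((\mathbb R^{d+1}))$ is identified with the family of its coefficients $\langle w,x\rangle$, and $\langle\pi,x\rangle=\sum_w a_w\langle w,x\rangle$ for $\pi=\sum_w a_w w$. A (not necessarily geometric) $p$-rough path over $[0,T]$ in $\mathbb R^{d+1}$ is a continuous map $(s,t)\mapsto\mathbf X_{s,t}=(1,X^1_{s,t},\dots,X^{\lfloor p\rfloor}_{s,t})$ on $\{0\le s\le t\le T\}$ with values in the tensor algebra truncated above degree $\lfloor p\rfloor$, with $\mathbf X_{s,t}=\mathbf X_{s,u}\otimes\mathbf X_{u,t}$ for $s\le u\le t$ and $$\|\mathbf X\|_p:=\max_{1\le i\le\lfloor p\rfloor}\ \sup_{(t_k)}\sum_k|X^i_{t_k,t_{k+1}}|^{p/i}<\infty ,$$ the supremum being over the partitions of $[0,T]$. Its signature $\mathbf X^{\le\infty}=\mathbf X^{\le\infty}_{0,T}$ is the value over $[0,T]$ of its unique continuous multiplicative extension of finite $p$-variation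 to all degrees (Lyons' extension). Let $\hat V^p$ be the set of time-extended $p$-rough paths $\hat{\mathbf X}$, i.e. those for which iterated integrals ending in an integration in time are classical: $\langle w0,\hat{\mathbf X}_{s,t}\rangle=\int_s^t\langle w,\hat{\mathbf X}_{s,r}\rangle\,dr$ for all words $w$ of length at most $\lfloor p\rfloor-1$ (in particular the $0$-th coordinate of the underlying path is $t$). Equip $\hat V^p$ with the $p$-variation distance $\max_{1\le i\le\lfloor p\rfloor}\sup_{(t_k)}\big(\sum_k|X^i_{t_k,t_{k+1}}-Y^i_{t_k,t_{k+1}}|^{p/i}\big)^{i/p}$ and its Borel $\sigma$-algebra. **Theorem.** Let $(\Omega,\mathcal F,\mathbb P)$ be a probability space and $\hat{\mathbf X}:\Omega\to\hat V^p$ a measurable map which is tight (for every $\delta>0$ there is a compact $\mathcal K\subset\hat V^p$ with $\mathbb P(\hat{\mathbf X}\in\mathcal K)\ge 1-\delta$) and has finite moments $\mathbb E[\|\hat{\mathbf X}\|_p^k]<\infty$ for all $k\in\mathbb N$. Let $F:\hat V^p\to\mathbb R$ be a Borel measurable payoff functional with $\mathbb E[|F(\hat{\mathbf X})|^q]<\infty$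 for some real $q\ge 1$, and let $\mathfrak p=\mathbb E[F(\hat{\mathbf X})]$ be its price. Then for every $\epsilon>0$ there are $n\in\mathbb N$, weighted words $\pi_1,\dots,\pi_n$, a finite set $\mathcal N\subset\mathbb N^n$, real numbers $(\alpha_m)_{m\in\mathcal N}$ and a compact set $\mathcal K\subset\hat V^p$ with $\mathbb P(\hat{\mathbf X}\in\mathcal K)\ge 1-\epsilon$ such that the signature correlators $$\rho_m=\mathbb E\Big[\prod_{i=1}^n\langle\pi_i,\hat{\mathbf X}^{\le\infty}\rangle^{m_i}\Big],\qquad m\in\mathcal N,$$ are well defined (the random variables in the brackets are integrable), the signature polynomial with coefficients $\alpha_m$ approximates the payoff on $\mathcal K$, $$\Big|F(\mathbf x)-\sum_{m\in\mathcal N}\alpha_m\prod_{i=1}^n\langle\pi_i,\mathbf x^{\le\infty}\rangle^{m_i}\Big|<\epsilon\qquad\text{for all }\mathbf x\in\mathcal K,$$ and its expectation approximates the price, $$\Big|\mathfrak p-\sum_{m\in\mathcal N}\alpha_m\rho_m\Big|<\epsilon .$$ -/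

import Mathlib

open scoped ENNReal

noncomputable section

/-- The extended tensor algebra `T((ℝ^{d+1}))`, in coordinates: a tensor series is given by its
coefficient at each word in the letters `0, 1, …, d` (the words of length `n` index the standard
orthonormal basis of `(ℝ^{d+1})^{⊗ n}`). The letter `0` is the time coordinate. -/
abbrev TensorSeries (d : ℕ) : Type := List (Fin (d + 1)) → ℝ

/-- The weighted words: finite real linear combinations of words. -/
abbrev WeightedWord (d : ℕ) : Type := List (Fin (d + 1)) →₀ ℝ

/-- The tensor product of two series: the coefficient at `w` is the sum over all ways of
writing `w` as a concatenation of two words. -/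
def tensorMul {d : ℕ} (x y : TensorSeries d) : TensorSeries d := fun w =>
  ∑ k ∈ Finset.range (w.length + 1), x (w.take k) * y (w.drop k)

/-- The dual pairing `⟨π, x⟩`. -/
def pairing {d : ℕ} (π : WeightedWord d) (x : TensorSeries d) : ℝ :=
  π.sum fun w a => a * x w

/-- The homogeneous component of degree `n`, as an element of `(ℝ^{d+1})^{⊗ n}` with its
Hilbert space norm. -/
def tensorLevel {d : ℕ} (n : ℕ) (x : TensorSeries d) :
    EuclideanSpace ℝ (Fin n → Fin (d + 1)) :=
  WithLp.toLp 2 fun v => x (List.ofFn v)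

/-- The simplex `{(s, t) | 0 ≤ s ≤ t ≤ T}`. -/
def timeSimplex (T : ℝ) : Set (ℝ × ℝ) := {q | 0 ≤ q.1 ∧ q.1 ≤ q.2 ∧ q.2 ≤ T}

/-- Finite increasing sequences of times in `[0, T]` (the first component is the number of
intervals). -/
abbrev TimePartition (T : ℝ) : Type :=
  ℕ × {u : ℕ → ℝ // Monotone u ∧ ∀ k, u k ∈ Set.Icc 0 T}

/-- `sup_P ∑_k |Z^n_{t_k, t_{k+1}}|^{p/n}`, the supremum being over the partitions of
`[0, T]`. -/
def levelVariation {d : ℕ} (p T : ℝ) (n : ℕ) (Z : ℝ → ℝ → TensorSeries d) : ℝ≥0∞ :=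
  ⨆ P : TimePartition T, ∑ k ∈ Finset.range P.1,
    ‖tensorLevel n (Z (P.2.1 k) (P.2.1 (k + 1)))‖ₑ ^ (p / (n : ℝ))

/-- A `p`-rough path over `[0, T]` in `ℝ^{d+1}`, not necessarily geometric: a continuous
multiplicative functional of degree `⌊p⌋` on the simplex with finite `p`-variation. The values
off the simplex and the coefficients of degree above `⌊p⌋` are set to zero, so that equality
in this type is equality of rough paths. -/
@[ext]
structure RoughPath (d : ℕ) (p T : ℝ) where
  toFun : ℝ → ℝ → TensorSeries d
  zero_off : ∀ s t w, ¬ ((s, t) ∈ timeSimplex T ∧ w.length ≤ ⌊p⌋₊) → toFun s t w = 0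
  unit : ∀ s t, (s, t) ∈ timeSimplex T → toFun s t [] = 1
  continuousOn : ∀ w, ContinuousOn (fun q : ℝ × ℝ => toFun q.1 q.2 w) (timeSimplex T)
  chen : ∀ s u t, 0 ≤ s → s ≤ u → u ≤ t → t ≤ T → ∀ w, w.length ≤ ⌊p⌋₊ →
    toFun s t w = tensorMul (toFun s u) (toFun u t) w
  finite_variation : ∀ i, 1 ≤ i → i ≤ ⌊p⌋₊ → levelVariation p T i toFun < ⊤

namespace RoughPath

variable {d : ℕ} {p T : ℝ}

theorem levelVariation_sub_self (n : ℕ) (hp : 0 < p / (n : ℝ)) (X : ℝ → ℝ → TensorSeries d) :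
    levelVariation p T n (fun s t => X s t - X s t) = 0 := by
  simp only [levelVariation, sub_self]
  have h0 : tensorLevel n (0 : TensorSeries d) = 0 := by ext; simp [tensorLevel]
  simp [h0, ENNReal.zero_rpow_of_pos hp]

theorem levelVariation_sub_comm (n : ℕ) (X Y : ℝ → ℝ → TensorSeries d) :
    levelVariation p T n (fun s t => X s t - Y s t)
      = levelVariation p T n (fun s t => Y s t - X s t) := by
  have h : ∀ x y : TensorSeries d, ‖tensorLevel n (x - y)‖ₑ = ‖tensorLevel n (y - x)‖ₑ := by
    intro x y
    rw [← enorm_neg]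
    congr 1
    ext v
    simp [tensorLevel]
  simp only [levelVariation, h]

theorem levelVariation_triangle (n : ℕ) (hp : 1 ≤ p / (n : ℝ))
    (X Y Z : ℝ → ℝ → TensorSeries d) :
    levelVariation p T n (fun s t => X s t - Z s t) ^ (1 / (p / (n : ℝ)))
      ≤ levelVariation p T n (fun s t => X s t - Y s t) ^ (1 / (p / (n : ℝ)))
        + levelVariation p T n (fun s t => Y s t - Z s t) ^ (1 / (p / (n : ℝ))) := by
  set r := p / (n : ℝ) with hr
  have hr0 : 0 < r := by linarith
  have hadd : ∀ x y z : TensorSeries d, ‖tensorLevel n (x - z)‖ₑ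
      ≤ ‖tensorLevel n (x - y)‖ₑ + ‖tensorLevel n (y - z)‖ₑ := by
    intro x y z
    have : tensorLevel n (x - z) = tensorLevel n (x - y) + tensorLevel n (y - z) := by
      ext v; simp [tensorLevel]
    rw [this]
    exact enorm_add_le _ _
  simp only [one_div]
  rw [ENNReal.rpow_inv_le_iff hr0]
  refine iSup_le fun P => ?_
  rw [← ENNReal.rpow_inv_le_iff hr0]
  refine le_trans (ENNReal.rpow_le_rpow (Finset.sum_le_sum fun k _ =>
    ENNReal.rpow_le_rpow (hadd _ (Y (P.2.1 k) (P.2.1 (k + 1))) _) hr0.le) (by positivity)) ?_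
  have hL := ENNReal.Lp_add_le (Finset.range P.1)
    (fun k => ‖tensorLevel n (X (P.2.1 k) (P.2.1 (k + 1)) - Y (P.2.1 k) (P.2.1 (k + 1)))‖ₑ)
    (fun k => ‖tensorLevel n (Y (P.2.1 k) (P.2.1 (k + 1)) - Z (P.2.1 k) (P.2.1 (k + 1)))‖ₑ) hp
  simp only [one_div] at hL
  refine le_trans hL ?_
  gcongr
  · exact le_iSup (fun P : TimePartition T => ∑ k ∈ Finset.range P.1,
      ‖tensorLevel n (X (P.2.1 k) (P.2.1 (k + 1)) - Y (P.2.1 k) (P.2.1 (k + 1)))‖ₑ ^ r) P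
  · exact le_iSup (fun P : TimePartition T => ∑ k ∈ Finset.range P.1,
      ‖tensorLevel n (Y (P.2.1 k) (P.2.1 (k + 1)) - Z (P.2.1 k) (P.2.1 (k + 1)))‖ₑ ^ r) P

theorem one_le_div_of_mem {i : ℕ} (hi : i ∈ Finset.Icc 1 ⌊p⌋₊) : 1 ≤ p / (i : ℝ) := by
  rw [Finset.mem_Icc] at hi
  have h1 : (0 : ℝ) < i := by exact_mod_cast hi.1
  have h2 : (i : ℝ) ≤ p := (Nat.le_floor_iff' (by omega)).1 hi.2
  rwa [le_div_iff₀ h1, one_mul]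

/-- The `p`-variation distance
`max_{1 ≤ i ≤ ⌊p⌋} (sup_P ∑_k |X^i_{t_k, t_{k+1}} - Y^i_{t_k, t_{k+1}}|^{p/i})^{i/p}`. -/
instance : EDist (RoughPath d p T) where
  edist X Y := ⨆ i ∈ Finset.Icc 1 ⌊p⌋₊,
    levelVariation p T i (fun s t => X.toFun s t - Y.toFun s t) ^ (1 / (p / (i : ℝ)))

theorem edist_def (X Y : RoughPath d p T) : edist X Y = ⨆ i ∈ Finset.Icc 1 ⌊p⌋₊,
    levelVariation p T i (fun s t => X.toFun s t - Y.toFun s t) ^ (1 / (p / (i : ℝ))) := rfl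

theorem eq_of_edist_zero {X Y : RoughPath d p T} (h : edist X Y = 0) : X = Y := by
  ext s t w
  by_cases hw : (s, t) ∈ timeSimplex T ∧ w.length ≤ ⌊p⌋₊
  swap
  · rw [X.zero_off s t w hw, Y.zero_off s t w hw]
  obtain ⟨hst, hlen⟩ := hw
  rcases Nat.eq_zero_or_pos w.length with h0 | hpos
  · rw [List.length_eq_zero_iff] at h0
    rw [h0, X.unit s t hst, Y.unit s t hst]
  have hi : w.length ∈ Finset.Icc 1 ⌊p⌋₊ := Finset.mem_Icc.2 ⟨hpos, hlen⟩
  have hr : 0 < p / (w.length : ℝ) := lt_of_lt_of_le one_pos (one_le_div_of_mem hi)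
  rw [edist_def] at h
  simp only [ENNReal.iSup_eq_zero] at h
  have h1 := h _ hi
  rw [ENNReal.rpow_eq_zero_iff_of_pos (by positivity)] at h1
  simp only [levelVariation, ENNReal.iSup_eq_zero] at h1
  have hst' : 0 ≤ s ∧ s ≤ t ∧ t ≤ T := hst
  have h2 := h1 (1, ⟨fun k => if k = 0 then s else t, by
    refine monotone_nat_of_le_succ fun k => ?_
    rcases k with _ | k <;> simp [hst'.2.1], by
    intro k
    by_cases hk : k = 0
    · simp only [hk, if_true]; exact ⟨hst'.1, hst'.2.1.trans hst'.2.2⟩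
    · simp only [hk, if_false]; exact ⟨hst'.1.trans hst'.2.1, hst'.2.2⟩⟩)
  simp only [Finset.sum_range_one, Nat.zero_add, if_true, one_ne_zero, if_false] at h2
  rw [ENNReal.rpow_eq_zero_iff_of_pos hr, enorm_eq_zero] at h2
  have h3 := congrArg (fun e : EuclideanSpace ℝ _ => e w.get) h2
  simp only [tensorLevel, List.ofFn_get, Pi.sub_apply, PiLp.zero_apply] at h3
  linarith

instance : EMetricSpace (RoughPath d p T) where
  edist_self X := by
    rw [edist_def]
    simp only [ENNReal.iSup_eq_zero]
    intro i hi
    have hr : 0 < p / (i : ℝ) := lt_of_lt_of_le one_pos (one_le_div_of_mem hi)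
    rw [levelVariation_sub_self i hr, ENNReal.zero_rpow_of_pos (by positivity)]
  edist_comm X Y := by
    simp only [edist_def, levelVariation_sub_comm _ X.toFun Y.toFun]
  edist_triangle X Y Z := by
    simp only [edist_def]
    refine iSup₂_le fun i hi => ?_
    refine le_trans (levelVariation_triangle i (one_le_div_of_mem hi) _ Y.toFun _) ?_
    gcongr
    · exact le_iSup₂ (f := fun i (_ : i ∈ Finset.Icc 1 ⌊p⌋₊) =>
        levelVariation p T i (fun s t => X.toFun s t - Y.toFun s t) ^ (1 / (p / (i : ℝ)))) i hi
    · exact le_iSup₂ (f := fun i (_ : i ∈ Finset.Icc 1 ⌊p⌋₊) =>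
        levelVariation p T i (fun s t => Y.toFun s t - Z.toFun s t) ^ (1 / (p / (i : ℝ)))) i hi
  eq_of_edist_eq_zero := eq_of_edist_zero

/-- The size `max_{1 ≤ i ≤ ⌊p⌋} sup_P ∑_k |X^i_{t_k, t_{k+1}}|^{p/i}` of a rough path. -/
def pVariation (X : RoughPath d p T) : ℝ :=
  (⨆ i ∈ Finset.Icc 1 ⌊p⌋₊, levelVariation p T i X.toFun).toReal

/-- The rough path lies over a time-extended path `(t, X_t)`: an iterated integral whose last
integration is against the time coordinate is the classical integral in time. For the empty word
this says that the coordinate `0` of the underlying path is `t`. -/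
def IsTimeExtended (X : RoughPath d p T) : Prop :=
  ∀ s t, (s, t) ∈ timeSimplex T → ∀ w, w.length + 1 ≤ ⌊p⌋₊ →
    X.toFun s t (w ++ [0]) = ∫ r in s..t, X.toFun s r w

/-- `S` is a Lyons extension of `X` to all degrees: a continuous multiplicative functional with
values in the extended tensor algebra, of finite `p`-variation in every degree, that agrees with
`X` up to degree `⌊p⌋`. -/
structure IsExtension (X : RoughPath d p T) (S : ℝ → ℝ → TensorSeries d) : Prop where
  agree : ∀ s t, (s, t) ∈ timeSimplex T → ∀ w, w.length ≤ ⌊p⌋₊ → S s t w = X.toFun s t w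
  continuousOn : ∀ w, ContinuousOn (fun q : ℝ × ℝ => S q.1 q.2 w) (timeSimplex T)
  chen : ∀ s u t, 0 ≤ s → s ≤ u → u ≤ t → t ≤ T → S s t = tensorMul (S s u) (S u t)
  finite_variation : ∀ i, 1 ≤ i → levelVariation p T i S < ⊤

open Classical in
/-- The signature `X^{≤ ∞}_{0,T}`: the value over `[0, T]` of the Lyons extension of `X` (which
exists and is unique on the simplex, for `1 ≤ p`). -/
def signature (X : RoughPath d p T) : TensorSeries d :=
  if h : ∃ S, X.IsExtension S then h.choose 0 T else 0

end RoughPath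

/-- The space of time-extended `p`-rough paths, with the `p`-variation distance. -/
def TimeExtendedRoughPath (d : ℕ) (p T : ℝ) : Type :=
  {X : RoughPath d p T // X.IsTimeExtended}

namespace TimeExtendedRoughPath

variable {d : ℕ} {p T : ℝ}

instance : EMetricSpace (TimeExtendedRoughPath d p T) :=
  inferInstanceAs (EMetricSpace {X : RoughPath d p T // X.IsTimeExtended})

instance : MeasurableSpace (TimeExtendedRoughPath d p T) := borel _

instance : BorelSpace (TimeExtendedRoughPath d p T) := ⟨rfl⟩

/-- The monomial `∏_i ⟨π_i, X^{≤ ∞}⟩^{m_i}` in the signature. -/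
def signatureMonomial {n : ℕ} (π : Fin n → WeightedWord d) (m : Fin n → ℕ)
    (X : TimeExtendedRoughPath d p T) : ℝ :=
  ∏ i, pairing (π i) X.1.signature ^ m i

/-- The signature correlator `ρ_m = E[∏_i ⟨π_i, X^{≤ ∞}⟩^{m_i}]` of a random rough path. -/
def correlator {Ω : Type*} [MeasurableSpace Ω] (P : MeasureTheory.Measure Ω)
    (X : Ω → TimeExtendedRoughPath d p T) {n : ℕ} (π : Fin n → WeightedWord d)
    (m : Fin n → ℕ) : ℝ :=
  ∫ ω, signatureMonomial π m (X ω) ∂P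

end TimeExtendedRoughPath

end

/-! The theorem is Stone-Weierstrass for the algebra generated by the coefficients of the signature,
on a large compact set, followed by a correction of the expectation. Rough paths here need not be
geometric, so products of coefficients are not linear in the signature; this is why polynomials in
the coefficients occur.

Three facts about the signature are needed. All rest on Lyons' extension, which is obtained degree
by degree from the sewing lemma: by Chen's relation a coefficient of degree n+1 is additive up to
products of lower coefficients, and above degree `⌊p⌋` this defect is a power greater than one of a
control (`exists_extension_bound`, `exists_isPartialExtension_succ`). (a) Coefficients are
continuous in the p-variation distance (`continuous_signature`), because the difference of two
extensions satisfies the same estimates with a small factor. (b) Coefficients grow polynomially in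
the size of the path (`exists_signature_growth`), so finite moments make every signature polynomial
integrable. (c) The signature separates time-extended paths (`eq_of_signature_eq`). The coefficients
at w followed by k zeros are k-fold time integrals of the coefficient at w; equality at T for all k
makes the difference of the w-coefficients orthogonal to all polynomials on `[0, T]`, hence zero.
Chen's relation then recovers the path on every interval.

Signature polynomials are unbounded, so closeness on a compact set K says nothing about
expectations. If K has full measure there is nothing to correct. Otherwise some signature polynomial
H is at most 1/2 in absolute value on K and at least 1 on a compact set of positive measure outside
K; high even powers of H are negligible on K while their integrals stay bounded below, so a multiple
of one absorbs the whole error in the price (`exists_mem_small_with_integral`). -/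

noncomputable section

/-! ### Controls. -/

/-- A control on `[0, T]`: a nonnegative superadditive function on the simplex. -/
structure IsControl (T : ℝ) (ω : ℝ → ℝ → ℝ) : Prop where
  nonneg : ∀ s t, 0 ≤ s → s ≤ t → t ≤ T → 0 ≤ ω s t
  add_le : ∀ s u t, 0 ≤ s → s ≤ u → u ≤ t → t ≤ T → ω s u + ω u t ≤ ω s t

namespace IsControl

variable {T : ℝ} {ω ω' : ℝ → ℝ → ℝ}

theorem self (h : IsControl T ω) {s : ℝ} (h0 : 0 ≤ s) (h1 : s ≤ T) : ω s s = 0 := by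
  have a := h.add_le s s s h0 le_rfl le_rfl h1
  have b := h.nonneg s s h0 le_rfl h1
  linarith

theorem mono (h : IsControl T ω) {s a b t : ℝ} (h0 : 0 ≤ s) (h1 : s ≤ a) (h2 : a ≤ b)
    (h3 : b ≤ t) (h4 : t ≤ T) : ω a b ≤ ω s t := by
  have e1 := h.add_le s a t h0 h1 (h2.trans h3) h4
  have e2 := h.add_le a b t (h0.trans h1) h2 h3 h4
  have e3 := h.nonneg s a h0 h1 ((h2.trans h3).trans h4)
  have e4 := h.nonneg b t (h0.trans (h1.trans h2)) h3 h4
  linarith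

theorem add (h : IsControl T ω) (h' : IsControl T ω') :
    IsControl T (fun s t => ω s t + ω' s t) where
  nonneg s t h0 h1 h2 := add_nonneg (h.nonneg s t h0 h1 h2) (h'.nonneg s t h0 h1 h2)
  add_le s u t h0 h1 h2 h3 := by
    have := h.add_le s u t h0 h1 h2 h3
    have := h'.add_le s u t h0 h1 h2 h3
    linarith

theorem const_mul (h : IsControl T ω) {c : ℝ} (hc : 0 ≤ c) :
    IsControl T (fun s t => c * ω s t) where
  nonneg s t h0 h1 h2 := mul_nonneg hc (h.nonneg s t h0 h1 h2)
  add_le s u t h0 h1 h2 h3 := by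
    rw [← mul_add]
    exact mul_le_mul_of_nonneg_left (h.add_le s u t h0 h1 h2 h3) hc

theorem zero : IsControl T (fun _ _ => 0) where
  nonneg _ _ _ _ _ := le_rfl
  add_le _ _ _ _ _ _ _ := by simp

theorem length : IsControl T (fun s t => t - s) where
  nonneg _ _ _ h _ := by simpa using h
  add_le _ _ _ _ _ _ _ := by linarith

theorem sum {ι : Type*} (A : Finset ι) {Ω : ι → ℝ → ℝ → ℝ} (h : ∀ i ∈ A, IsControl T (Ω i)) :
    IsControl T (fun s t => ∑ i ∈ A, Ω i s t) where
  nonneg s t h0 h1 h2 := Finset.sum_nonneg fun i hi => (h i hi).nonneg s t h0 h1 h2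
  add_le s u t h0 h1 h2 h3 := by
    rw [← Finset.sum_add_distrib]
    exact Finset.sum_le_sum fun i hi => (h i hi).add_le s u t h0 h1 h2 h3

theorem sum_le (h : IsControl T ω) {u : ℕ → ℝ} (hu : Monotone u)
    (hmem : ∀ k, u k ∈ Set.Icc 0 T) (N : ℕ) :
    ∑ k ∈ Finset.range N, ω (u k) (u (k + 1)) ≤ ω (u 0) (u N) := by
  induction N with
  | zero => simpa using h.nonneg _ _ (hmem 0).1 le_rfl (hmem 0).2
  | succ N ih =>
    rw [Finset.sum_range_succ]
    have := h.add_le (u 0) (u N) (u (N + 1)) (hmem 0).1 (hu (Nat.zero_le _))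
      (hu (Nat.le_succ _)) (hmem _).2
    linarith

end IsControl

/-! ### The sewing lemma and its uniqueness counterpart. -/

/-- The constant `2 / (1 - 2 ^ (1 - θ))` of the sewing lemma. -/
def sewConst (θ : ℝ) : ℝ := 2 / (1 - 2 ^ (1 - θ))

theorem two_rpow_lt_one {θ : ℝ} (hθ : 1 < θ) : (2 : ℝ) ^ (1 - θ) < 1 :=
  Real.rpow_lt_one_of_one_lt_of_neg one_lt_two (by linarith)

theorem sewConst_pos {θ : ℝ} (hθ : 1 < θ) : 0 < sewConst θ := by
  have := two_rpow_lt_one hθ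
  exact div_pos two_pos (by linarith)

/-- The fixed-point equation of the induction in `abs_sub_sum_le`: two defects, plus two pieces
whose control has been halved. -/
theorem sewConst_eq {θ : ℝ} (hθ : 1 < θ) :
    2 + 2 * (sewConst θ * (1 / 2 : ℝ) ^ θ) = sewConst θ := by
  have h := two_rpow_lt_one hθ
  have h2 : 2 * (1 / 2 : ℝ) ^ θ = 2 ^ (1 - θ) := by
    rw [Real.rpow_sub two_pos, Real.rpow_one, Real.div_rpow one_pos.le two_pos.le, Real.one_rpow]
    ring
  have h3 : 2 * (sewConst θ * (1 / 2 : ℝ) ^ θ) = sewConst θ * 2 ^ (1 - θ) := by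
    rw [← h2]; ring
  rw [h3, sewConst]
  have : (1 - (2 : ℝ) ^ (1 - θ)) ≠ 0 := by linarith
  field_simp
  ring

/-- The defect of additivity of the germ `Ξ` is at most `C ω ^ θ`. -/
def DefectLE (T : ℝ) (Ξ : ℝ → ℝ → ℝ) (ω : ℝ → ℝ → ℝ) (θ C : ℝ) : Prop :=
  ∀ s u t, 0 ≤ s → s ≤ u → u ≤ t → t ≤ T → |Ξ s t - Ξ s u - Ξ u t| ≤ C * ω s t ^ θ

section Sewing

variable {T : ℝ} {ω : ℝ → ℝ → ℝ} {Ξ : ℝ → ℝ → ℝ} {θ C : ℝ}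

theorem DefectLE.self_eq_zero (h : DefectLE T Ξ ω θ C) (hω : IsControl T ω) (hθ : 1 < θ) {s : ℝ}
    (h0 : 0 ≤ s) (h1 : s ≤ T) : Ξ s s = 0 := by
  have := h s s s h0 le_rfl le_rfl h1
  rw [hω.self h0 h1, Real.zero_rpow (by linarith)] at this
  simpa using this

/-- Let j + 1 be the first index where the control counted from `u a` exceeds half of the total, or
b if there is none. The part before j is at most half by minimality, the part after j + 1 by
superadditivity. -/
theorem exists_balanced_index (hω : IsControl T ω) {u : ℕ → ℝ} (hu : Monotone u)
    (hmem : ∀ k, u k ∈ Set.Icc 0 T) {a b : ℕ} (hab : a < b) :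
    ∃ j, a ≤ j ∧ j < b ∧ ω (u a) (u j) ≤ ω (u a) (u b) / 2 ∧
      ω (u (j + 1)) (u b) ≤ ω (u a) (u b) / 2 := by
  classical
  have hW : 0 ≤ ω (u a) (u b) := hω.nonneg _ _ (hmem a).1 (hu hab.le) (hmem b).2
  have hex : ∃ m, a < m ∧ (b ≤ m ∨ ω (u a) (u b) / 2 < ω (u a) (u m)) := ⟨b, hab, Or.inl le_rfl⟩
  obtain ⟨hm1, hm2⟩ := Nat.find_spec hex
  have hmin := fun k => Nat.find_min hex (m := k)
  set m := Nat.find hex with hm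
  have hmb : m ≤ b := Nat.find_min' hex ⟨hab, Or.inl le_rfl⟩
  obtain ⟨j, hj⟩ : ∃ j, m = j + 1 := ⟨m - 1, by omega⟩
  refine ⟨j, by omega, by omega, ?_, ?_⟩
  · rcases Nat.eq_or_lt_of_le (show a ≤ j by omega) with h | h
    · rw [← h, hω.self (hmem a).1 (hmem a).2]; linarith
    · have := hmin j (by omega)
      push Not at this
      exact (this h).2
  · rw [← hj]
    rcases Nat.eq_or_lt_of_le hmb with h | h
    · rw [h, hω.self (hmem b).1 (hmem b).2]; linarith
    · have h1 : ω (u a) (u b) / 2 < ω (u a) (u m) := by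
        rcases hm2 with h2 | h2
        · omega
        · exact h2
      have := hω.add_le _ _ _ (hmem a).1 (hu hm1.le) (hu hmb) (hmem b).2
      linarith

/-- Cut at the balanced index into two pieces of at most half the control and a single interval
between them, which is already a term of the sum. Since θ > 1, the halved pieces cost less than the
whole, so the constant does not depend on the number of points. -/
theorem DefectLE.abs_sub_sum_le (h : DefectLE T Ξ ω θ C) (hω : IsControl T ω) (hθ : 1 < θ)
    (hC : 0 ≤ C) {u : ℕ → ℝ} (hu : Monotone u) (hmem : ∀ k, u k ∈ Set.Icc 0 T) {a b : ℕ}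
    (hab : a ≤ b) :
    |Ξ (u a) (u b) - ∑ k ∈ Finset.Ico a b, Ξ (u k) (u (k + 1))|
      ≤ sewConst θ * C * ω (u a) (u b) ^ θ := by
  have hK := sewConst_pos hθ
  induction hN : b - a using Nat.strong_induction_on generalizing a b with
  | _ N ih =>
  have hW : 0 ≤ ω (u a) (u b) := hω.nonneg _ _ (hmem a).1 (hu hab) (hmem b).2
  rcases Nat.eq_or_lt_of_le hab with rfl | hlt
  · simp only [Finset.Ico_self, Finset.sum_empty, sub_zero]
    rw [h.self_eq_zero hω hθ (hmem a).1 (hmem a).2, abs_zero]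
    positivity
  obtain ⟨j, haj, hjb, h1, h2⟩ := exists_balanced_index hω hu hmem hlt
  have i1 := ih (j - a) (by omega) haj rfl
  have i2 := ih (b - (j + 1)) (by omega) (show j + 1 ≤ b by omega) rfl
  have e1 := h (u a) (u j) (u b) (hmem a).1 (hu haj) (hu hjb.le) (hmem b).2
  have e2 := h (u j) (u (j + 1)) (u b) (hmem j).1 (hu (by omega)) (hu (by omega)) (hmem b).2
  have hpow : ∀ {x : ℝ}, 0 ≤ x → x ≤ ω (u a) (u b) / 2 →
      x ^ θ ≤ (1 / 2 : ℝ) ^ θ * ω (u a) (u b) ^ θ := by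
    intro x hx hx'
    rw [← Real.mul_rpow (by norm_num) hW]
    exact Real.rpow_le_rpow hx (by linarith) (by linarith)
  have p1 := hpow (hω.nonneg _ _ (hmem a).1 (hu haj) (hmem j).2) h1
  have p2 := hpow (hω.nonneg _ _ (hmem (j + 1)).1 (hu (show j + 1 ≤ b by omega)) (hmem b).2) h2
  have p3 : ω (u j) (u b) ^ θ ≤ ω (u a) (u b) ^ θ :=
    Real.rpow_le_rpow (hω.nonneg _ _ (hmem j).1 (hu hjb.le) (hmem b).2)
      (hω.mono (hmem a).1 (hu haj) (hu hjb.le) le_rfl (hmem b).2) (by linarith)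
  have hsum : ∑ k ∈ Finset.Ico a b, Ξ (u k) (u (k + 1))
      = ∑ k ∈ Finset.Ico a j, Ξ (u k) (u (k + 1)) + Ξ (u j) (u (j + 1))
        + ∑ k ∈ Finset.Ico (j + 1) b, Ξ (u k) (u (k + 1)) := by
    rw [← Finset.sum_Ico_consecutive _ haj hjb.le, Finset.sum_eq_sum_Ico_succ_bot hjb]
    ring
  have hKC : 0 ≤ sewConst θ * C := by positivity
  have q1 := mul_le_mul_of_nonneg_left p1 hKC
  have q2 := mul_le_mul_of_nonneg_left p2 hKC
  have q3 := mul_le_mul_of_nonneg_left p3 hC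
  have hfin : sewConst θ * C * ω (u a) (u b) ^ θ
      = 2 * (C * ω (u a) (u b) ^ θ)
        + 2 * (sewConst θ * C * ((1 / 2 : ℝ) ^ θ * ω (u a) (u b) ^ θ)) := by
    have := sewConst_eq hθ
    nth_rewrite 1 [← this]
    ring
  rw [hsum, hfin]
  rw [abs_le] at *
  constructor <;> linarith

/-- `Z` is negligible against a control near the diagonal. -/
def NearlyNull (T : ℝ) (Z : ℝ → ℝ → ℝ) : Prop :=
  ∃ ω, IsControl T ω ∧ ∀ η > 0, ∃ δ > 0, ∀ s t, 0 ≤ s → s ≤ t → t ≤ T → t - s < δ →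
    |Z s t| ≤ η * ω s t

theorem NearlyNull.sub {Z Z' : ℝ → ℝ → ℝ} (h : NearlyNull T Z) (h' : NearlyNull T Z') :
    NearlyNull T (fun s t => Z s t - Z' s t) := by
  obtain ⟨ω, hω, H⟩ := h
  obtain ⟨ω', hω', H'⟩ := h'
  refine ⟨_, hω.add hω', fun η hη => ?_⟩
  obtain ⟨δ, hδ, D⟩ := H η hη
  obtain ⟨δ', hδ', D'⟩ := H' η hη
  refine ⟨min δ δ', lt_min hδ hδ', fun s t h0 h1 h2 h3 => ?_⟩
  have a := D s t h0 h1 h2 (h3.trans_le (min_le_left _ _))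
  have b := D' s t h0 h1 h2 (h3.trans_le (min_le_right _ _))
  have := abs_sub (Z s t) (Z' s t)
  rw [mul_add]
  linarith

/-- The uniform partition of `[s, t]` into `N` intervals. -/
def uniformGrid (s t : ℝ) (N k : ℕ) : ℝ := s + (t - s) * ((min k N : ℕ) / N)

theorem uniformGrid_mono {s t : ℝ} (h : s ≤ t) (N : ℕ) : Monotone (uniformGrid s t N) := by
  intro a b hab
  have : min a N ≤ min b N := min_le_min_right _ hab
  have : ((min a N : ℕ) : ℝ) ≤ (min b N : ℕ) := by exact_mod_cast this
  unfold uniformGrid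
  have := sub_nonneg.2 h
  gcongr

theorem uniformGrid_zero (s t : ℝ) (N : ℕ) : uniformGrid s t N 0 = s := by simp [uniformGrid]

theorem uniformGrid_last (s t : ℝ) {N : ℕ} (h : 0 < N) : uniformGrid s t N N = t := by
  have : (N : ℝ) ≠ 0 := by positivity
  simp [uniformGrid, this]

theorem uniformGrid_mem {s t : ℝ} (h : s ≤ t) {N : ℕ} (hN : 0 < N) (k : ℕ) :
    uniformGrid s t N k ∈ Set.Icc s t := by
  have h0 := uniformGrid_mono h N (Nat.zero_le k)
  rw [uniformGrid_zero] at h0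
  refine ⟨h0, ?_⟩
  have h1 := uniformGrid_mono h N (le_max_left k N)
  have h2 : uniformGrid s t N (max k N) = uniformGrid s t N N := by simp [uniformGrid]
  rwa [h2, uniformGrid_last s t hN] at h1

theorem uniformGrid_step {s t : ℝ} (h : s ≤ t) (N k : ℕ) :
    uniformGrid s t N (k + 1) - uniformGrid s t N k ≤ (t - s) / N := by
  have h1 : min (k + 1) N ≤ min k N + 1 := by omega
  have h2 : ((min (k + 1) N : ℕ) : ℝ) ≤ (min k N : ℕ) + 1 := by exact_mod_cast h1
  have h3 : ((min (k + 1) N : ℕ) : ℝ) / N ≤ ((min k N : ℕ) + 1) / N := by gcongr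
  have h4 := mul_le_mul_of_nonneg_left h3 (sub_nonneg.2 h)
  unfold uniformGrid
  rw [add_div] at h4
  have : (t - s) / N = (t - s) * (1 / N) := by ring
  linarith

theorem exists_nat_div_lt (c : ℝ) {δ : ℝ} (hδ : 0 < δ) :
    ∃ N₀ : ℕ, 0 < N₀ ∧ ∀ N ≥ N₀, c / N < δ := by
  have h : Filter.Tendsto (fun N : ℕ => c / N) Filter.atTop (nhds 0) :=
    tendsto_const_div_atTop_nhds_zero_nat c
  obtain ⟨N₀, h⟩ := Filter.eventually_atTop.1 (h.eventually (gt_mem_nhds hδ))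
  exact ⟨N₀ + 1, by omega, fun N hN => h N (by omega)⟩

/-- A negligible `Z` whose defect of additivity is at most `C ω ^ θ` is itself at most a
multiple of `ω ^ θ`. -/
theorem DefectLE.abs_le_of_nearlyNull (h : DefectLE T Ξ ω θ C) (hω : IsControl T ω)
    (hθ : 1 < θ) (hC : 0 ≤ C) (hn : NearlyNull T Ξ) {s t : ℝ} (h0 : 0 ≤ s) (h1 : s ≤ t)
    (h2 : t ≤ T) : |Ξ s t| ≤ sewConst θ * C * ω s t ^ θ := by
  obtain ⟨μ, hμ, H⟩ := hn
  refine le_of_forall_pos_le_add fun ε hε => ?_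
  have hμ0 := hμ.nonneg s t h0 h1 h2
  obtain ⟨δ, hδ, D⟩ := H (ε / (μ s t + 1)) (by positivity)
  obtain ⟨N, hN, hNδ⟩ := exists_nat_div_lt (t - s) hδ
  have hmono := uniformGrid_mono h1 N
  have hm : ∀ k, uniformGrid s t N k ∈ Set.Icc 0 T := fun k =>
    ⟨h0.trans (uniformGrid_mem h1 hN k).1, (uniformGrid_mem h1 hN k).2.trans h2⟩
  have e1 := h.abs_sub_sum_le hω hθ hC hmono hm (Nat.zero_le N)
  have e2 := hμ.sum_le hmono hm N
  rw [uniformGrid_zero, uniformGrid_last s t hN] at e1 e2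
  rw [← Finset.range_eq_Ico] at e1
  -- Negligibility makes the sum over a fine grid small, so only the error of the partition estimate
  -- remains.
  have e3 : |∑ k ∈ Finset.range N, Ξ (uniformGrid s t N k) (uniformGrid s t N (k + 1))| ≤ ε := by
    refine (Finset.abs_sum_le_sum_abs _ _).trans ?_
    calc _ ≤ ∑ k ∈ Finset.range N,
          ε / (μ s t + 1) * μ (uniformGrid s t N k) (uniformGrid s t N (k + 1)) := by
          refine Finset.sum_le_sum fun k _ => D _ _ (hm k).1 (hmono (Nat.le_succ k)) (hm _).2 ?_
          exact (uniformGrid_step h1 N k).trans_lt (hNδ N le_rfl)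
      _ ≤ ε / (μ s t + 1) * μ s t := by
          rw [← Finset.mul_sum]; gcongr
      _ ≤ ε := by
          rw [div_mul_eq_mul_div, div_le_iff₀ (by positivity)]
          nlinarith
  rw [abs_le] at *
  constructor <;> linarith

theorem eq_zero_of_additive_of_nearlyNull {Z : ℝ → ℝ → ℝ}
    (hadd : ∀ s u t, 0 ≤ s → s ≤ u → u ≤ t → t ≤ T → Z s t = Z s u + Z u t)
    (hn : NearlyNull T Z) {s t : ℝ} (h0 : 0 ≤ s) (h1 : s ≤ t) (h2 : t ≤ T) : Z s t = 0 := by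
  -- An additive function has no defect, so the zero control is admissible; the exponent 2 is
  -- arbitrary.
  have hd : DefectLE T Z (fun _ _ => 0) 2 0 := fun s u t h0 h1 h2 h3 => by
    rw [hadd s u t h0 h1 h2 h3]; simp
  simpa using hd.abs_le_of_nearlyNull IsControl.zero one_lt_two le_rfl hn h0 h1 h2

/-- Clamping to `[s, t]`. -/
def clampTo (s t x : ℝ) : ℝ := max s (min x t)

theorem clampTo_mono (s t : ℝ) : Monotone (clampTo s t) := fun _ _ h =>
  max_le_max_left _ (min_le_min_right _ h)

theorem clampTo_mem {s t : ℝ} (h : s ≤ t) (x : ℝ) : clampTo s t x ∈ Set.Icc s t :=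
  ⟨le_max_left _ _, max_le h (min_le_right _ _)⟩

theorem clampTo_sub_le {s t x y : ℝ} (h : x ≤ y) : clampTo s t y - clampTo s t x ≤ y - x := by
  unfold clampTo
  rcases le_total y t with h1 | h1 <;> rcases le_total x t with h2 | h2 <;>
    simp only [min_eq_left, min_eq_right, h1, h2] <;>
    rcases max_cases s y with h3 | h3 <;> rcases max_cases s x with h4 | h4 <;>
    rcases max_cases s t with h5 | h5 <;> linarith

/-- The Riemann sum of the germ over the uniform grid of `[0, T]`, clamped to `[s, t]`. -/
def gridSum (T : ℝ) (Ξ : ℝ → ℝ → ℝ) (N : ℕ) (s t : ℝ) : ℝ :=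
  ∑ k ∈ Finset.range N, Ξ (clampTo s t (uniformGrid 0 T N k))
    (clampTo s t (uniformGrid 0 T N (k + 1)))

theorem DefectLE.abs_gridSum_sub_le (h : DefectLE T Ξ ω θ C) (hω : IsControl T ω) (hθ : 1 < θ)
    (hC : 0 ≤ C) {s t : ℝ} (h0 : 0 ≤ s) (h1 : s ≤ t) (h2 : t ≤ T) {N : ℕ} (hN : 0 < N) :
    |Ξ s t - gridSum T Ξ N s t| ≤ sewConst θ * C * ω s t ^ θ := by
  have hT : 0 ≤ T := h0.trans (h1.trans h2)
  have := h.abs_sub_sum_le hω hθ hC (u := fun k => clampTo s t (uniformGrid 0 T N k))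
    ((clampTo_mono s t).comp (uniformGrid_mono hT N))
    (fun k => ⟨h0.trans (clampTo_mem h1 _).1, (clampTo_mem h1 _).2.trans h2⟩) (Nat.zero_le N)
  rw [← Finset.range_eq_Ico] at this
  simp only [uniformGrid_zero, uniformGrid_last 0 T hN] at this
  have hs : clampTo s t 0 = s := by simp [clampTo, h0.trans h1, h0]
  have ht : clampTo s t T = t := by simp [clampTo, h2, h1]
  rwa [hs, ht] at this

/-- If u lies outside the cell, one half of it degenerates to a point, where the germ vanishes, and
there is no defect. Otherwise u cuts the cell and the defect of the germ applies. -/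
theorem DefectLE.abs_clampTo_le (h : DefectLE T Ξ ω θ C) (hω : IsControl T ω) (hθ : 1 < θ)
    (hC : 0 ≤ C) {s u t x y : ℝ} (h0 : 0 ≤ s) (h1 : s ≤ u) (h2 : u ≤ t) (h3 : t ≤ T)
    (hxy : x ≤ y) :
    |Ξ (clampTo s t x) (clampTo s t y) - Ξ (clampTo s u x) (clampTo s u y)
      - Ξ (clampTo u t x) (clampTo u t y)| ≤ C * ω (clampTo s t x) (clampTo s t y) ^ θ := by
  have hst := h1.trans h2
  have huu : Ξ u u = 0 := h.self_eq_zero hω hθ (h0.trans h1) (h2.trans h3)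
  have hmx := clampTo_mem hst x
  have hmy := clampTo_mem hst y
  have hnn : 0 ≤ ω (clampTo s t x) (clampTo s t y) :=
    hω.nonneg _ _ (h0.trans hmx.1) (clampTo_mono s t hxy) (hmy.2.trans h3)
  have hlow : ∀ z, z ≤ u → clampTo s u z = clampTo s t z ∧ clampTo u t z = u := by
    intro z hz
    simp [clampTo, hz, hz.trans h2]
  have hhigh : ∀ z, u ≤ z → clampTo s u z = u ∧ clampTo u t z = clampTo s t z := by
    intro z hz
    have : u ≤ min z t := le_min hz h2
    simp [clampTo, hz, h1, this, h1.trans this]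
  have hpos : 0 ≤ C * ω (clampTo s t x) (clampTo s t y) ^ θ := by positivity
  rcases le_total y u with hy | hy
  · rw [(hlow y hy).1, (hlow y hy).2, (hlow x (hxy.trans hy)).1, (hlow x (hxy.trans hy)).2, huu]
    simpa using hpos
  rcases le_total u x with hx | hx
  · rw [(hhigh y hy).1, (hhigh y hy).2, (hhigh x hx).1, (hhigh x hx).2, huu]
    simpa using hpos
  rw [(hhigh y hy).1, (hhigh y hy).2, (hlow x hx).1, (hlow x hx).2]
  refine h _ _ _ (h0.trans hmx.1) ?_ ?_ (hmy.2.trans h3)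
  · rw [← (hlow x hx).1]; exact (clampTo_mem h1 x).2
  · rw [← (hhigh y hy).2]; exact (clampTo_mem h2 y).1

/-- The control tends to zero at the diagonal. -/
def VanishesAtDiagonal (T : ℝ) (ω : ℝ → ℝ → ℝ) : Prop :=
  ∀ η > 0, ∃ δ > 0, ∀ s t, 0 ≤ s → s ≤ t → t ≤ T → t - s < δ → |ω s t| ≤ η

theorem VanishesAtDiagonal.rpow_le (hv : VanishesAtDiagonal T ω) (hω : IsControl T ω)
    (hθ : 1 < θ) {η : ℝ} (hη : 0 < η) :
    ∃ δ > 0, ∀ s t, 0 ≤ s → s ≤ t → t ≤ T → t - s < δ → ω s t ^ θ ≤ η * ω s t := by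
  obtain ⟨δ, hδ, D⟩ := hv (η ^ (1 / (θ - 1))) (by positivity)
  refine ⟨δ, hδ, fun s t h0 h1 h2 h3 => ?_⟩
  have hn := hω.nonneg s t h0 h1 h2
  have hd := D s t h0 h1 h2 h3
  rw [abs_of_nonneg hn] at hd
  have e : ω s t ^ θ = ω s t ^ (θ - 1) * ω s t := by
    rcases hn.eq_or_lt with h | h
    · rw [← h, Real.zero_rpow (by linarith), mul_zero]
    · rw [← Real.rpow_add_one h.ne']; ring_nf
  rw [e]
  refine mul_le_mul_of_nonneg_right ?_ hn
  calc ω s t ^ (θ - 1) ≤ (η ^ (1 / (θ - 1))) ^ (θ - 1) :=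
        Real.rpow_le_rpow hn hd (by linarith)
    _ = η := by
        rw [← Real.rpow_mul hη.le, one_div_mul_cancel (by linarith), Real.rpow_one]

/-- All intervals use the same global grid, so the sums compare cell by cell. On small cells `ω ^ θ
≤ η ω`, and superadditivity sums these bounds. -/
theorem DefectLE.tendsto_gridSum_defect (h : DefectLE T Ξ ω θ C) (hω : IsControl T ω)
    (hθ : 1 < θ) (hC : 0 ≤ C) (hv : VanishesAtDiagonal T ω) {s u t : ℝ} (h0 : 0 ≤ s)
    (h1 : s ≤ u) (h2 : u ≤ t) (h3 : t ≤ T) :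
    Filter.Tendsto (fun N => gridSum T Ξ N s t - gridSum T Ξ N s u - gridSum T Ξ N u t)
      Filter.atTop (nhds 0) := by
  have hT : 0 ≤ T := h0.trans (h1.trans (h2.trans h3))
  have hst := h1.trans h2
  rw [Metric.tendsto_atTop]
  intro ε hε
  have hW := hω.nonneg s t h0 hst h3
  obtain ⟨δ, hδ, D⟩ := hv.rpow_le hω hθ (η := ε / (C * ω s t + 1)) (by positivity)
  obtain ⟨N₀, hN₀, hNδ⟩ := exists_nat_div_lt T hδ
  refine ⟨N₀, fun N hN => ?_⟩
  have hNpos : 0 < N := by omega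
  rw [Real.dist_eq, sub_zero]
  unfold gridSum
  rw [← Finset.sum_sub_distrib, ← Finset.sum_sub_distrib]
  have hmono : Monotone fun k => clampTo s t (uniformGrid 0 T N k) :=
    (clampTo_mono s t).comp (uniformGrid_mono hT N)
  have hmem : ∀ k, clampTo s t (uniformGrid 0 T N k) ∈ Set.Icc 0 T := fun k =>
    ⟨h0.trans (clampTo_mem hst _).1, (clampTo_mem hst _).2.trans h3⟩
  have hsum := hω.sum_le hmono hmem N
  have hle : ω (clampTo s t (uniformGrid 0 T N 0)) (clampTo s t (uniformGrid 0 T N N)) ≤ ω s t :=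
    hω.mono h0 (clampTo_mem hst _).1 (hmono (Nat.zero_le N)) (clampTo_mem hst _).2 h3
  calc _ ≤ ∑ k ∈ Finset.range N, C * (ε / (C * ω s t + 1) *
          ω (clampTo s t (uniformGrid 0 T N k)) (clampTo s t (uniformGrid 0 T N (k + 1)))) := by
        refine (Finset.abs_sum_le_sum_abs _ _).trans (Finset.sum_le_sum fun k _ => ?_)
        refine (h.abs_clampTo_le hω hθ hC h0 h1 h2 h3
          (uniformGrid_mono hT N (Nat.le_succ k))).trans ?_
        refine mul_le_mul_of_nonneg_left ?_ hC
        refine D _ _ (hmem k).1 (hmono (Nat.le_succ k)) (hmem _).2 ?_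
        refine (clampTo_sub_le (uniformGrid_mono hT N (Nat.le_succ k))).trans_lt ?_
        refine (uniformGrid_step hT N k).trans_lt ?_
        simpa using hNδ N hN
    _ ≤ C * (ε / (C * ω s t + 1) * ω s t) := by
        rw [← Finset.mul_sum, ← Finset.mul_sum]
        gcongr
        exact hsum.trans hle
    _ < ε := by
        have : C * (ε / (C * ω s t + 1) * ω s t) = ε * (C * ω s t) / (C * ω s t + 1) := by ring
        rw [this, div_lt_iff₀ (by positivity)]
        nlinarith

/-- The sewing lemma: a germ whose defect of additivity is controlled is uniformly close to an
additive function, with the bound that every admissible control gives. -/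
theorem exists_sewing (h : DefectLE T Ξ ω θ C) (hω : IsControl T ω) (hθ : 1 < θ) (hC : 0 ≤ C)
    (hv : VanishesAtDiagonal T ω) :
    ∃ I : ℝ → ℝ → ℝ,
      (∀ s u t, 0 ≤ s → s ≤ u → u ≤ t → t ≤ T → I s t = I s u + I u t) ∧
      ∀ (μ : ℝ → ℝ → ℝ) (τ D : ℝ), IsControl T μ → 1 < τ → 0 ≤ D → DefectLE T Ξ μ τ D →
        ∀ s t, 0 ≤ s → s ≤ t → t ≤ T → |I s t - Ξ s t| ≤ sewConst τ * D * μ s t ^ τ := by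
  -- The grid sums are bounded, so they converge along an ultrafilter; no Cauchy estimate is needed.
  have hlim : ∀ s t, 0 ≤ s ∧ s ≤ t ∧ t ≤ T → ∃ l, Filter.Tendsto
      (fun N => gridSum T Ξ N s t) (Filter.hyperfilter ℕ : Filter ℕ) (nhds l) := by
    rintro s t ⟨h0, h1, h2⟩
    set B := sewConst θ * C * ω s t ^ θ
    have hev : ∀ᶠ N in (Filter.hyperfilter ℕ : Filter ℕ),
        gridSum T Ξ N s t ∈ Set.Icc (Ξ s t - B) (Ξ s t + B) := by
      refine Filter.Eventually.filter_mono Nat.hyperfilter_le_atTop ?_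
      filter_upwards [Filter.eventually_gt_atTop 0] with N hN
      have := h.abs_gridSum_sub_le hω hθ hC h0 h1 h2 hN
      rw [abs_le] at this
      constructor <;> linarith
    obtain ⟨l, -, hl⟩ := (isCompact_Icc (a := Ξ s t - B) (b := Ξ s t + B)).ultrafilter_le_nhds
      ((Filter.hyperfilter ℕ).map fun N => gridSum T Ξ N s t)
      (by rw [Filter.le_principal_iff]; exact hev)
    exact ⟨l, hl⟩
  classical
  choose I hI using hlim
  refine ⟨fun s t => if hs : 0 ≤ s ∧ s ≤ t ∧ t ≤ T then I s t hs else 0, ?_, ?_⟩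
  · intro s u t h0 h1 h2 h3
    have a1 : 0 ≤ s ∧ s ≤ t ∧ t ≤ T := ⟨h0, h1.trans h2, h3⟩
    have a2 : 0 ≤ s ∧ s ≤ u ∧ u ≤ T := ⟨h0, h1, h2.trans h3⟩
    have a3 : 0 ≤ u ∧ u ≤ t ∧ t ≤ T := ⟨h0.trans h1, h2, h3⟩
    simp only [a1, a2, a3, and_self, dite_true]
    have l1 := ((hI s t a1).sub (hI s u a2)).sub (hI u t a3)
    have l2 := (h.tendsto_gridSum_defect hω hθ hC hv h0 h1 h2 h3).mono_left
      Nat.hyperfilter_le_atTop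
    have := tendsto_nhds_unique l1 l2
    linarith
  · intro μ τ D hμ hτ hD hd s t h0 h1 h2
    have a1 : 0 ≤ s ∧ s ≤ t ∧ t ≤ T := ⟨h0, h1, h2⟩
    simp only [a1, and_self, dite_true]
    -- The grid sums do not involve the control, so the limit inherits the bound of every admissible
    -- control, not only of the one used to construct it.
    refine le_of_tendsto ((hI s t a1).sub_const (Ξ s t)).abs ?_
    refine Filter.Eventually.filter_mono Nat.hyperfilter_le_atTop ?_
    filter_upwards [Filter.eventually_gt_atTop 0] with N hN
    rw [abs_sub_comm]
    exact hd.abs_gridSum_sub_le hμ hτ hD h0 h1 h2 hN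

end Sewing

/-! ### Variation over partitions as a control. -/

/-- The total of `f` over partitions of `[s, t]`, maximised over the partitions. -/
def variation (f : ℝ → ℝ → ℝ≥0∞) (s t : ℝ) : ℝ≥0∞ :=
  ⨆ P : ℕ × {u : ℕ → ℝ // Monotone u ∧ ∀ k, u k ∈ Set.Icc s t},
    ∑ k ∈ Finset.range P.1, f (P.2.1 k) (P.2.1 (k + 1))

section Variation

variable {f g : ℝ → ℝ → ℝ≥0∞} {s t u T : ℝ}

theorem sum_le_variation (f : ℝ → ℝ → ℝ≥0∞) (N : ℕ) {v : ℕ → ℝ} (hv : Monotone v)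
    (hm : ∀ k, v k ∈ Set.Icc s t) :
    ∑ k ∈ Finset.range N, f (v k) (v (k + 1)) ≤ variation f s t :=
  le_iSup (fun P : ℕ × {u : ℕ → ℝ // Monotone u ∧ ∀ k, u k ∈ Set.Icc s t} =>
    ∑ k ∈ Finset.range P.1, f (P.2.1 k) (P.2.1 (k + 1))) (N, ⟨v, hv, hm⟩)

theorem le_variation (f : ℝ → ℝ → ℝ≥0∞) (h : s ≤ t) : f s t ≤ variation f s t := by
  have := sum_le_variation f 1 (uniformGrid_mono h 1) (uniformGrid_mem h one_pos)
  simpa [uniformGrid] using this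

theorem variation_mono {a b : ℝ} (h1 : s ≤ a) (h2 : b ≤ t) :
    variation f a b ≤ variation f s t :=
  iSup_le fun P => sum_le_variation f P.1 P.2.2.1 fun k =>
    ⟨h1.trans (P.2.2.2 k).1, (P.2.2.2 k).2.trans h2⟩

theorem variation_add_le (h1 : s ≤ u) (h2 : u ≤ t) :
    variation f s u + variation f u t ≤ variation f s t := by
  have this : ∀ a b : ℝ, ∀ h : a ≤ b,
      Nonempty (ℕ × {u : ℕ → ℝ // Monotone u ∧ ∀ k, u k ∈ Set.Icc a b}) := fun a b h =>
    ⟨(0, ⟨fun _ => a, monotone_const, fun _ => ⟨le_rfl, h⟩⟩)⟩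
  have _ := this s u h1
  have _ := this u t h2
  unfold variation
  refine ENNReal.iSup_add_iSup_le fun P Q => ?_
  -- Concatenation of the two partitions. The shift by `P.1 + 1` keeps the last point of the first;
  -- the interval bridging the two only adds a nonnegative term, dropped below.
  set v : ℕ → ℝ := fun k => if k ≤ P.1 then P.2.1 k else Q.2.1 (k - (P.1 + 1)) with hv
  have hmono : Monotone v := by
    intro a b hab
    simp only [hv]
    split_ifs with h3 h4 h4
    · exact P.2.2.1 hab
    · exact (P.2.2.2 a).2.trans (Q.2.2.2 _).1
    · omega
    · exact Q.2.2.1 (by omega)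
  have hm : ∀ k, v k ∈ Set.Icc s t := by
    intro k
    simp only [hv]
    split_ifs
    · exact ⟨(P.2.2.2 k).1, (P.2.2.2 k).2.trans h2⟩
    · exact ⟨h1.trans (Q.2.2.2 _).1, (Q.2.2.2 _).2⟩
  refine le_trans ?_ (sum_le_variation f (P.1 + 1 + Q.1) hmono hm)
  rw [Finset.sum_range_add, Finset.sum_range_succ]
  gcongr ?_ + ?_
  · refine le_trans (Finset.sum_le_sum fun k hk => ?_) le_self_add
    have hk' := Finset.mem_range.1 hk
    simp only [hv, hk'.le, if_true, show k + 1 ≤ P.1 from hk']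
    exact le_rfl
  · refine Finset.sum_le_sum fun k _ => ?_
    simp only [hv, show ¬ P.1 + 1 + k ≤ P.1 by omega, if_false,
      show ¬ P.1 + 1 + k + 1 ≤ P.1 by omega, show P.1 + 1 + k - (P.1 + 1) = k by omega,
      show P.1 + 1 + k + 1 - (P.1 + 1) = k + 1 by omega]
    exact le_rfl

theorem variation_le_mul {c : ℝ≥0∞} (h : ∀ a b, s ≤ a → a ≤ b → b ≤ t → f a b ≤ c * g a b) :
    variation f s t ≤ c * variation g s t := by
  refine iSup_le fun P => ?_
  calc _ ≤ ∑ k ∈ Finset.range P.1, c * g (P.2.1 k) (P.2.1 (k + 1)) :=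
        Finset.sum_le_sum fun k _ => h _ _ (P.2.2.2 k).1 (P.2.2.1 (Nat.le_succ k)) (P.2.2.2 _).2
    _ ≤ _ := by
        rw [← Finset.mul_sum]
        gcongr
        exact sum_le_variation g P.1 P.2.2.1 P.2.2.2

theorem variation_le_control {ω : ℝ → ℝ → ℝ} (hω : IsControl T ω)
    (h : ∀ a b, 0 ≤ a → a ≤ b → b ≤ T → f a b ≤ ENNReal.ofReal (ω a b)) :
    variation f 0 T ≤ ENNReal.ofReal (ω 0 T) := by
  refine iSup_le fun P => ?_
  have hm := P.2.2.2
  calc _ ≤ ∑ k ∈ Finset.range P.1, ENNReal.ofReal (ω (P.2.1 k) (P.2.1 (k + 1))) :=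
        Finset.sum_le_sum fun k _ => h _ _ (hm k).1 (P.2.2.1 (Nat.le_succ k)) (hm _).2
    _ = ENNReal.ofReal (∑ k ∈ Finset.range P.1, ω (P.2.1 k) (P.2.1 (k + 1))) :=
        (ENNReal.ofReal_sum_of_nonneg fun k _ =>
          hω.nonneg _ _ (hm k).1 (P.2.2.1 (Nat.le_succ k)) (hm _).2).symm
    _ ≤ _ := ENNReal.ofReal_le_ofReal ((hω.sum_le P.2.2.1 hm P.1).trans
        (hω.mono le_rfl (hm 0).1 (P.2.2.1 (Nat.zero_le _)) (hm _).2 le_rfl))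

theorem isControl_variation (h : variation f 0 T ≠ ⊤) :
    IsControl T (fun s t => (variation f s t).toReal) where
  nonneg _ _ _ _ _ := ENNReal.toReal_nonneg
  add_le s u t h0 h1 h2 h3 := by
    have hne : ∀ a b, 0 ≤ a → b ≤ T → variation f a b ≠ ⊤ := fun a b ha hb =>
      ne_top_of_le_ne_top h (variation_mono ha hb)
    rw [← ENNReal.toReal_add (hne _ _ h0 (h2.trans h3)) (hne _ _ (h0.trans h1) h3)]
    exact ENNReal.toReal_mono (hne _ _ h0 h3) (variation_add_le h1 h2)

end Variation

/-! ### Size of the homogeneous levels. -/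

section Level

variable {d : ℕ} {p T : ℝ} {Z : ℝ → ℝ → TensorSeries d}

theorem abs_apply_le_norm_tensorLevel (x : TensorSeries d) (w : List (Fin (d + 1))) :
    |x w| ≤ ‖tensorLevel w.length x‖ := by
  have h := PiLp.norm_apply_le (tensorLevel w.length x) w.get
  simpa [tensorLevel, List.ofFn_get] using h

theorem norm_tensorLevel_le (n : ℕ) {x : TensorSeries d} {B : ℝ}
    (h : ∀ w, w.length = n → |x w| ≤ B) :
    ‖tensorLevel n x‖ ≤ √(Fintype.card (Fin n → Fin (d + 1))) * B := by
  have hB : 0 ≤ B := (abs_nonneg _).trans (h (List.replicate n 0) (by simp))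
  rw [EuclideanSpace.norm_eq, ← Real.sqrt_sq hB, ← Real.sqrt_mul (by positivity)]
  refine Real.sqrt_le_sqrt ?_
  have : ∀ v ∈ (Finset.univ : Finset (Fin n → Fin (d + 1))),
      ‖tensorLevel n x v‖ ^ 2 ≤ B ^ 2 := fun v _ => by
    gcongr
    exact h (List.ofFn v) (by simp)
  simpa using Finset.sum_le_card_nsmul _ _ _ this

theorem enorm_rpow_eq {E : Type*} [NormedAddCommGroup E] (x : E) {r : ℝ} (hr : 0 ≤ r) :
    ‖x‖ₑ ^ r = ENNReal.ofReal (‖x‖ ^ r) := by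
  rw [← ENNReal.ofReal_rpow_of_nonneg (norm_nonneg _) hr, ofReal_norm]

/-- The `p / n`-variation of the level `n` over `[s, t]`, as a real number. -/
def levelControl (p : ℝ) (n : ℕ) (Z : ℝ → ℝ → TensorSeries d) (s t : ℝ) : ℝ :=
  (variation (fun s t => ‖tensorLevel n (Z s t)‖ₑ ^ (p / (n : ℝ))) s t).toReal

theorem levelVariation_eq (n : ℕ) : levelVariation p T n Z
    = variation (fun s t => ‖tensorLevel n (Z s t)‖ₑ ^ (p / (n : ℝ))) 0 T := rfl

theorem levelControl_full (n : ℕ) : levelControl p n Z 0 T = (levelVariation p T n Z).toReal := rfl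

theorem isControl_levelControl {n : ℕ} (h : levelVariation p T n Z < ⊤) :
    IsControl T (levelControl p n Z) :=
  isControl_variation h.ne

theorem norm_rpow_le_levelControl (hp : 0 ≤ p) {n : ℕ} (h : levelVariation p T n Z < ⊤) {s t : ℝ}
    (h0 : 0 ≤ s) (h1 : s ≤ t) (h2 : t ≤ T) :
    ‖tensorLevel n (Z s t)‖ ^ (p / (n : ℝ)) ≤ levelControl p n Z s t := by
  have hle := le_variation (fun s t => ‖tensorLevel n (Z s t)‖ₑ ^ (p / (n : ℝ))) h1
  have hne := ne_top_of_le_ne_top h.ne (variation_mono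
    (f := fun s t => ‖tensorLevel n (Z s t)‖ₑ ^ (p / (n : ℝ))) h0 h2)
  have := ENNReal.toReal_mono hne hle
  rw [enorm_rpow_eq _ (by positivity), ENNReal.toReal_ofReal (by positivity)] at this
  exact this

theorem norm_le_levelControl_rpow (hp : 0 < p) {n : ℕ} (hn : 1 ≤ n)
    (h : levelVariation p T n Z < ⊤) {s t : ℝ} (h0 : 0 ≤ s) (h1 : s ≤ t) (h2 : t ≤ T) :
    ‖tensorLevel n (Z s t)‖ ≤ levelControl p n Z s t ^ ((n : ℝ) / p) := by
  have hn' : (0 : ℝ) < n := by exact_mod_cast hn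
  have h3 := norm_rpow_le_levelControl hp.le h h0 h1 h2
  have h4 := Real.rpow_le_rpow (by positivity) h3 (show 0 ≤ (n : ℝ) / p by positivity)
  rwa [← Real.rpow_mul (norm_nonneg _), div_mul_div_cancel₀ hn'.ne', div_self hp.ne',
    Real.rpow_one] at h4

theorem isCompact_timeSimplex (T : ℝ) : IsCompact (timeSimplex T) := by
  have hc : IsClosed (timeSimplex T) := by
    unfold timeSimplex
    exact (isClosed_le continuous_const continuous_fst).inter
      ((isClosed_le continuous_fst continuous_snd).inter
        (isClosed_le continuous_snd continuous_const))
  refine (isCompact_Icc.prod isCompact_Icc : IsCompact (Set.Icc 0 T ×ˢ Set.Icc 0 T)).of_isClosed_subset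
    hc fun q hq => ?_
  obtain ⟨a, b, c⟩ := hq
  exact ⟨⟨a, b.trans c⟩, a.trans b, c⟩

theorem vanishesAtDiagonal_of_continuousOn {f : ℝ → ℝ → ℝ}
    (hf : ContinuousOn (fun q : ℝ × ℝ => f q.1 q.2) (timeSimplex T))
    (h0 : ∀ s, 0 ≤ s → s ≤ T → f s s = 0) : VanishesAtDiagonal T f := by
  intro η hη
  have hu := (isCompact_timeSimplex T).uniformContinuousOn_of_continuous hf
  rw [Metric.uniformContinuousOn_iff_le] at hu
  obtain ⟨δ, hδ, D⟩ := hu η hη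
  refine ⟨δ, hδ, fun s t hs hst ht hd => ?_⟩
  have := D (s, t) ⟨hs, hst, ht⟩ (s, s) ⟨hs, le_rfl, hst.trans ht⟩ (by
    rw [Prod.dist_eq, dist_self, Real.dist_eq, abs_of_nonneg (sub_nonneg.2 hst)]
    exact max_le hδ.le hd.le)
  simpa [h0 s hs (hst.trans ht), Real.dist_eq] using this

theorem vanishesAtDiagonal_norm_tensorLevel {n : ℕ}
    (h : ∀ w, w.length = n → VanishesAtDiagonal T fun s t => Z s t w) :
    VanishesAtDiagonal T fun s t => ‖tensorLevel n (Z s t)‖ := by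
  intro η hη
  set c := √(Fintype.card (Fin n → Fin (d + 1)) : ℝ)
  have hc : 0 < c := Real.sqrt_pos.2 (by exact_mod_cast Fintype.card_pos)
  choose δ hδ D using fun v : Fin n → Fin (d + 1) =>
    h (List.ofFn v) (by simp) (η / c) (by positivity)
  obtain ⟨δ₀, hδ₀, hle⟩ : ∃ δ₀ > 0, ∀ v, δ₀ ≤ δ v := by
    refine ⟨Finset.univ.inf' Finset.univ_nonempty δ, ?_, fun v => Finset.inf'_le _ (by simp)⟩
    simpa [Finset.lt_inf'_iff] using hδ
  refine ⟨δ₀, hδ₀, fun s t h0 h1 h2 h3 => ?_⟩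
  rw [abs_of_nonneg (norm_nonneg _)]
  refine (norm_tensorLevel_le n (B := η / c) fun w hw => ?_).trans ?_
  · subst hw
    have := D w.get s t h0 h1 h2 (h3.trans_le (hle _))
    rwa [List.ofFn_get] at this
  · exact (mul_div_cancel₀ η hc.ne').le

/-- Above the degree `p`, a coefficient of finite variation is negligible. -/
theorem nearlyNull_of_levelVariation (hp : 0 < p) {w : List (Fin (d + 1))} (hw : p < w.length)
    (h : levelVariation p T w.length Z < ⊤) (hv : VanishesAtDiagonal T fun s t => Z s t w) :
    NearlyNull T fun s t => Z s t w := by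
  refine ⟨_, isControl_levelControl h, fun η hη => ?_⟩
  have hn : (0 : ℝ) < w.length := hp.trans hw
  have hq : p / (w.length : ℝ) < 1 := (div_lt_one hn).2 hw
  obtain ⟨δ, hδ, D⟩ := hv (η ^ (1 / (1 - p / (w.length : ℝ))))
    (Real.rpow_pos_of_pos hη _)
  refine ⟨δ, hδ, fun s t h0 h1 h2 h3 => ?_⟩
  have hd := D s t h0 h1 h2 h3
  set x := |Z s t w|
  have hx : 0 ≤ x := abs_nonneg _
  have hxl : x ^ (p / (w.length : ℝ)) ≤ levelControl p w.length Z s t :=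
    (Real.rpow_le_rpow hx (abs_apply_le_norm_tensorLevel _ w) (by positivity)).trans
      (norm_rpow_le_levelControl hp.le h h0 h1 h2)
  -- The exponent `p / w.length` is below one: that power is bounded by the control, and the
  -- remaining positive power tends to zero at the diagonal.
  have e : x = x ^ (1 - p / (w.length : ℝ)) * x ^ (p / (w.length : ℝ)) := by
    rw [← Real.rpow_add' hx (by simp)]; simp
  have e2 : x ^ (1 - p / (w.length : ℝ)) ≤ η := by
    refine (Real.rpow_le_rpow hx hd (by linarith)).trans_eq ?_
    rw [← Real.rpow_mul hη.le, one_div_mul_cancel (by linarith), Real.rpow_one]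
  rw [e]
  gcongr

theorem levelVariation_lt_top_of_le {p' : ℝ} (hp : 0 < p) (hpp : p ≤ p') {n : ℕ} (hn : 1 ≤ n)
    (h : levelVariation p T n Z < ⊤) : levelVariation p' T n Z < ⊤ := by
  have hn' : (0 : ℝ) < n := by exact_mod_cast hn
  rw [levelVariation_eq]
  set c : ℝ≥0∞ := ENNReal.ofReal ((levelControl p n Z 0 T ^ ((n : ℝ) / p)) ^ ((p' - p) / n))
  refine (variation_le_mul (c := c)
    (g := fun s t => ‖tensorLevel n (Z s t)‖ₑ ^ (p / (n : ℝ))) fun a b ha hab hb => ?_).trans_lt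
    (ENNReal.mul_lt_top ENNReal.ofReal_lt_top h)
  have e : p' / (n : ℝ) = (p' - p) / n + p / n := by ring
  rw [e, ENNReal.rpow_add_of_nonneg _ _ (div_nonneg (by linarith) hn'.le) (by positivity)]
  gcongr
  rw [enorm_rpow_eq _ (div_nonneg (by linarith) hn'.le)]
  have hc := isControl_levelControl h
  refine ENNReal.ofReal_le_ofReal (Real.rpow_le_rpow (norm_nonneg _) ?_
    (div_nonneg (by linarith) hn'.le))
  refine (norm_le_levelControl_rpow hp hn h ha hab hb).trans ?_
  exact Real.rpow_le_rpow (hc.nonneg _ _ ha hab hb) (hc.mono le_rfl ha hab hb le_rfl)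
    (by positivity)

/-- With a larger exponent, the excess power of each increment is uniformly small near the diagonal
and the rest is bounded by the total p-variation. This avoids proving continuity of the p-variation
control itself. -/
theorem vanishesAtDiagonal_levelControl {p' : ℝ} (hp : 0 < p) (hpp : p < p') {n : ℕ}
    (hn : 1 ≤ n) (h : levelVariation p T n Z < ⊤)
    (hv : VanishesAtDiagonal T fun s t => ‖tensorLevel n (Z s t)‖) :
    VanishesAtDiagonal T (levelControl p' n Z) := by
  intro η hη
  have hn' : (0 : ℝ) < n := by exact_mod_cast hn
  set M := levelControl p n Z 0 T
  have hM : 0 ≤ M := ENNReal.toReal_nonneg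
  have hr : 0 < (p' - p) / (n : ℝ) := div_pos (by linarith) hn'
  obtain ⟨δ, hδ, D⟩ := hv ((η / (M + 1)) ^ (1 / ((p' - p) / (n : ℝ)))) (by positivity)
  refine ⟨δ, hδ, fun s t h0 h1 h2 h3 => ?_⟩
  have key : variation (fun s t => ‖tensorLevel n (Z s t)‖ₑ ^ (p' / (n : ℝ))) s t
      ≤ ENNReal.ofReal (η / (M + 1)) *
        variation (fun s t => ‖tensorLevel n (Z s t)‖ₑ ^ (p / (n : ℝ))) s t := by
    refine variation_le_mul fun a b ha hab hb => ?_
    have e : p' / (n : ℝ) = (p' - p) / n + p / n := by ring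
    rw [e, ENNReal.rpow_add_of_nonneg _ _ hr.le (by positivity)]
    gcongr
    rw [enorm_rpow_eq _ hr.le]
    refine ENNReal.ofReal_le_ofReal ?_
    have hd := D a b (h0.trans ha) hab (hb.trans h2) (by linarith)
    rw [abs_of_nonneg (norm_nonneg _)] at hd
    refine (Real.rpow_le_rpow (norm_nonneg _) hd hr.le).trans_eq ?_
    rw [← Real.rpow_mul (by positivity), one_div_mul_cancel hr.ne', Real.rpow_one]
  rw [levelControl, abs_of_nonneg ENNReal.toReal_nonneg]
  have k2 : variation (fun s t => ‖tensorLevel n (Z s t)‖ₑ ^ (p' / (n : ℝ))) s t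
      ≤ ENNReal.ofReal (η / (M + 1)) * levelVariation p T n Z :=
    key.trans (by gcongr; exact variation_mono h0 h2)
  have k3 := ENNReal.toReal_mono (ENNReal.mul_ne_top ENNReal.ofReal_ne_top h.ne) k2
  rw [ENNReal.toReal_mul, ENNReal.toReal_ofReal (by positivity)] at k3
  refine k3.trans ?_
  rw [← levelControl_full, div_mul_eq_mul_div, div_le_iff₀ (by positivity)]
  nlinarith

end Level

/-! ### Splittings of words and the tensor product. -/

section TensorAlgebra

variable {d : ℕ}

/-- The contribution to the coefficient of `w` in a product that comes from the splittings of
`w` into two nonempty words. -/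
def splitSum (x y : TensorSeries d) (w : List (Fin (d + 1))) : ℝ :=
  ∑ k ∈ Finset.Ico 1 w.length, x (w.take k) * y (w.drop k)

theorem tensorMul_nil (x y : TensorSeries d) : tensorMul x y [] = x [] * y [] := by
  simp [tensorMul]

theorem tensorMul_cons (x y : TensorSeries d) (a : Fin (d + 1)) (w : List (Fin (d + 1))) :
    tensorMul x y (a :: w) = x [] * y (a :: w) + tensorMul (fun v => x (a :: v)) y w := by
  simp only [tensorMul, List.length_cons]
  rw [Finset.sum_range_succ']
  simp [add_comm]

theorem tensorMul_add_left (x x' y : TensorSeries d) (w : List (Fin (d + 1))) :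
    tensorMul (fun v => x v + x' v) y w = tensorMul x y w + tensorMul x' y w := by
  simp [tensorMul, add_mul, Finset.sum_add_distrib]

theorem tensorMul_smul_left (c : ℝ) (x y : TensorSeries d) (w : List (Fin (d + 1))) :
    tensorMul (fun v => c * x v) y w = c * tensorMul x y w := by
  simp [tensorMul, Finset.mul_sum, mul_assoc]

theorem tensorMul_assoc (x y z : TensorSeries d) (w : List (Fin (d + 1))) :
    tensorMul (tensorMul x y) z w = tensorMul x (tensorMul y z) w := by
  induction w generalizing x y with
  | nil => simp [tensorMul_nil, mul_assoc]
  | cons a w ih =>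
    rw [tensorMul_cons, tensorMul_cons, tensorMul_nil, tensorMul_cons]
    have : (fun v => tensorMul x y (a :: v))
        = fun v => x [] * y (a :: v) + tensorMul (fun v => x (a :: v)) y v := by
      funext v; rw [tensorMul_cons]
    rw [this, tensorMul_add_left, tensorMul_smul_left (x []) (fun v => y (a :: v)), ih]
    ring

/-- With unit constant terms, this shows that Chen's relation is additivity up to a term involving
only shorter words. -/
theorem tensorMul_eq_splitSum (x y : TensorSeries d) {w : List (Fin (d + 1))} (hw : w ≠ []) :
    tensorMul x y w = x [] * y w + x w * y [] + splitSum x y w := by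
  have hl : 0 < w.length := List.length_pos_iff.2 hw
  rw [tensorMul, Finset.sum_range_succ, Finset.range_eq_Ico, Finset.sum_eq_sum_Ico_succ_bot hl,
    splitSum]
  simp
  ring

theorem splitSum_congr {x x' y y' : TensorSeries d} {w : List (Fin (d + 1))}
    (hx : ∀ v, v.length < w.length → x v = x' v) (hy : ∀ v, v.length < w.length → y v = y' v) :
    splitSum x y w = splitSum x' y' w := by
  refine Finset.sum_congr rfl fun k hk => ?_
  rw [Finset.mem_Ico] at hk
  rw [hx _ (by simp; omega), hy _ (by simp; omega)]

theorem tensorMul_congr {x x' y y' : TensorSeries d} {w : List (Fin (d + 1))}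
    (hx : ∀ v, v.length ≤ w.length → x v = x' v) (hy : ∀ v, v.length ≤ w.length → y v = y' v) :
    tensorMul x y w = tensorMul x' y' w := by
  refine Finset.sum_congr rfl fun k hk => ?_
  rw [hx _ (by simp), hy _ (by simp)]

/-- The cocycle identity behind associativity. -/
theorem splitSum_cocycle {a b c ab bc : TensorSeries d} {w : List (Fin (d + 1))} (hw : w ≠ [])
    (ha : a [] = 1) (hb : b [] = 1) (hc : c [] = 1)
    (hab : ∀ v, v.length < w.length → ab v = tensorMul a b v)
    (hbc : ∀ v, v.length < w.length → bc v = tensorMul b c v) :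
    splitSum ab c w + splitSum a b w = splitSum a bc w + splitSum b c w := by
  have h := tensorMul_assoc a b c w
  rw [tensorMul_eq_splitSum _ _ hw, tensorMul_eq_splitSum _ _ hw, tensorMul_eq_splitSum _ _ hw,
    tensorMul_eq_splitSum _ _ hw, tensorMul_nil, tensorMul_nil, ha, hb, hc,
    ← splitSum_congr hab (fun _ _ => rfl), ← splitSum_congr (fun _ _ => rfl) hbc] at h
  linarith

theorem abs_splitSum_le {x y : TensorSeries d} {w : List (Fin (d + 1))} {B : ℝ}
    (h : ∀ k ∈ Finset.Ico 1 w.length, |x (w.take k)| * |y (w.drop k)| ≤ B) :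
    |splitSum x y w| ≤ (w.length - 1 : ℕ) * B := by
  refine (Finset.abs_sum_le_sum_abs _ _).trans ?_
  have := Finset.sum_le_card_nsmul (Finset.Ico 1 w.length)
    (fun k => |x (w.take k) * y (w.drop k)|) B (fun k hk => by rw [abs_mul]; exact h k hk)
  simpa using this

theorem splitSum_sub (x x' y y' : TensorSeries d) (w : List (Fin (d + 1))) :
    splitSum x' y' w - splitSum x y w
      = splitSum (x' - x) y' w + splitSum x (y' - y) w := by
  simp only [splitSum, ← Finset.sum_sub_distrib, ← Finset.sum_add_distrib, Pi.sub_apply]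
  exact Finset.sum_congr rfl fun k _ => by ring

end TensorAlgebra

/-! ### Lyons' extension: uniqueness, estimates, existence. -/

theorem rpow_mul_rpow_le {x y z a b : ℝ} (hx : 0 ≤ x) (hy : 0 ≤ y) (hxz : x ≤ z) (hyz : y ≤ z)
    (ha : 0 ≤ a) (hb : 0 ≤ b) : x ^ a * y ^ b ≤ z ^ (a + b) := by
  rw [Real.rpow_add_of_nonneg (hx.trans hxz) ha hb]
  have := hx.trans hxz
  gcongr

/-- The coefficients of degrees `1, …, L` of `Z` have size at most `ε ω ^ (degree / r)`. -/
def Dominates {d : ℕ} (T : ℝ) (L : ℕ) (r ε : ℝ) (ω : ℝ → ℝ → ℝ) (Z : ℝ → ℝ → TensorSeries d) :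
    Prop :=
  ∀ s t, 0 ≤ s → s ≤ t → t ≤ T → ∀ w, 1 ≤ w.length → w.length ≤ L →
    |Z s t w| ≤ ε * ω s t ^ ((w.length : ℝ) / r)

theorem levelVariation_lt_top_of_bound {d n : ℕ} {p T B : ℝ} {ω : ℝ → ℝ → ℝ}
    {Z : ℝ → ℝ → TensorSeries d} (hω : IsControl T ω) (hp : 0 < p) (hn : 1 ≤ n) (hB : 0 ≤ B)
    (h : ∀ s t, 0 ≤ s → s ≤ t → t ≤ T → ∀ w, w.length = n →
      |Z s t w| ≤ B * ω s t ^ ((n : ℝ) / p)) :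
    levelVariation p T n Z < ⊤ := by
  have hn' : (0 : ℝ) < n := by exact_mod_cast hn
  set c := √(Fintype.card (Fin n → Fin (d + 1)) : ℝ)
  have hc : 0 ≤ c := Real.sqrt_nonneg _
  rw [levelVariation_eq]
  refine (variation_le_control (hω.const_mul (c := (c * B) ^ (p / (n : ℝ))) (by positivity))
    fun a b h0 h1 h2 => ?_).trans_lt ENNReal.ofReal_lt_top
  rw [enorm_rpow_eq _ (by positivity)]
  refine ENNReal.ofReal_le_ofReal ?_
  have hω0 := hω.nonneg a b h0 h1 h2
  have := norm_tensorLevel_le n fun w hw => h a b h0 h1 h2 w hw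
  rw [← mul_assoc] at this
  refine (Real.rpow_le_rpow (norm_nonneg _) this (by positivity)).trans_eq ?_
  rw [Real.mul_rpow (by positivity) (by positivity), ← Real.rpow_mul hω0,
    div_mul_div_cancel₀ hp.ne', div_self hn'.ne', Real.rpow_one]

namespace RoughPath

variable {d : ℕ} {p T : ℝ}

/-- `S` is a multiplicative extension of `X` up to the degree `n`. -/
structure IsPartialExtension (X : RoughPath d p T) (n : ℕ) (S : ℝ → ℝ → TensorSeries d) :
    Prop where
  agree : ∀ s t, (s, t) ∈ timeSimplex T → ∀ w, w.length ≤ ⌊p⌋₊ → S s t w = X.toFun s t w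
  continuousOn : ∀ w, w.length ≤ n →
    ContinuousOn (fun q : ℝ × ℝ => S q.1 q.2 w) (timeSimplex T)
  chen : ∀ s u t, 0 ≤ s → s ≤ u → u ≤ t → t ≤ T → ∀ w, w.length ≤ n →
    S s t w = tensorMul (S s u) (S u t) w
  finite_variation : ∀ i, 1 ≤ i → i ≤ n → levelVariation p T i S < ⊤

theorem isPartialExtension_self (X : RoughPath d p T) : X.IsPartialExtension ⌊p⌋₊ X.toFun where
  agree _ _ _ _ _ := rfl
  continuousOn w _ := X.continuousOn w
  chen := X.chen
  finite_variation := X.finite_variation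

theorem IsExtension.isPartialExtension {X : RoughPath d p T} {S : ℝ → ℝ → TensorSeries d}
    (h : X.IsExtension S) (n : ℕ) : X.IsPartialExtension n S where
  agree := h.agree
  continuousOn w _ := h.continuousOn w
  chen s u t h0 h1 h2 h3 w _ := by rw [← h.chen s u t h0 h1 h2 h3]
  finite_variation i hi _ := h.finite_variation i hi

namespace IsPartialExtension

variable {X : RoughPath d p T} {n : ℕ} {S : ℝ → ℝ → TensorSeries d}

theorem apply_nil (h : X.IsPartialExtension n S) {s t : ℝ} (h0 : 0 ≤ s) (h1 : s ≤ t)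
    (h2 : t ≤ T) : S s t [] = 1 := by
  rw [h.agree s t ⟨h0, h1, h2⟩ [] (by simp), X.unit s t ⟨h0, h1, h2⟩]

theorem chen_splitSum (h : X.IsPartialExtension n S) {s u t : ℝ} (h0 : 0 ≤ s) (h1 : s ≤ u)
    (h2 : u ≤ t) (h3 : t ≤ T) {w : List (Fin (d + 1))} (hw : w ≠ []) (hn : w.length ≤ n) :
    S s t w = S s u w + S u t w + splitSum (S s u) (S u t) w := by
  rw [h.chen s u t h0 h1 h2 h3 w hn, tensorMul_eq_splitSum _ _ hw,
    h.apply_nil h0 h1 (h2.trans h3), h.apply_nil (h0.trans h1) h2 h3]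
  ring

theorem self_eq_zero (h : X.IsPartialExtension n S) {s : ℝ} (h0 : 0 ≤ s) (h1 : s ≤ T)
    (w : List (Fin (d + 1))) (hw : w ≠ []) (hn : w.length ≤ n) : S s s w = 0 := by
  induction hm : w.length using Nat.strong_induction_on generalizing w with
  | _ m ih =>
  have h3 := h.chen_splitSum h0 le_rfl le_rfl h1 hw hn
  have h4 : splitSum (S s s) (S s s) w = 0 := by
    refine Finset.sum_eq_zero fun k hk => ?_
    rw [Finset.mem_Ico] at hk
    have hl : (w.take k).length = k := by simp; omega
    have hne : w.take k ≠ [] := by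
      rw [← List.length_pos_iff, hl]; omega
    rw [ih k (by omega) (w.take k) hne (by omega) hl, zero_mul]
  linarith

theorem vanishesAtDiagonal (h : X.IsPartialExtension n S) {w : List (Fin (d + 1))}
    (hw : w ≠ []) (hn : w.length ≤ n) : VanishesAtDiagonal T fun s t => S s t w :=
  vanishesAtDiagonal_of_continuousOn (h.continuousOn w hn)
    fun _ h0 h1 => h.self_eq_zero h0 h1 w hw hn

theorem nearlyNull (h : X.IsPartialExtension n S) (hp : 1 ≤ p) {w : List (Fin (d + 1))}
    (hw : ⌊p⌋₊ < w.length) (hn : w.length ≤ n) : NearlyNull T fun s t => S s t w := by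
  have hne : w ≠ [] := by rw [← List.length_pos_iff]; omega
  exact nearlyNull_of_levelVariation (by linarith) ((Nat.floor_lt (by linarith)).1 hw)
    (h.finite_variation _ (by omega) hn) (h.vanishesAtDiagonal hne hn)

/-- By induction on the degree the splitting terms of both extensions agree, so their difference at
`w` is additive. Above degree `⌊p⌋` it is also negligible near the diagonal, hence zero. -/
theorem unique {n' : ℕ} {S' : ℝ → ℝ → TensorSeries d} (h : X.IsPartialExtension n S)
    (h' : X.IsPartialExtension n' S') (hp : 1 ≤ p) {s t : ℝ} (h0 : 0 ≤ s) (h1 : s ≤ t)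
    (h2 : t ≤ T) (w : List (Fin (d + 1))) (hn : w.length ≤ n) (hn' : w.length ≤ n') :
    S s t w = S' s t w := by
  induction hm : w.length using Nat.strong_induction_on generalizing w s t with
  | _ m ih =>
  rcases le_or_gt w.length ⌊p⌋₊ with hl | hl
  · rw [h.agree s t ⟨h0, h1, h2⟩ w hl, h'.agree s t ⟨h0, h1, h2⟩ w hl]
  have hne : w ≠ [] := by rw [← List.length_pos_iff]; omega
  refine sub_eq_zero.1 (eq_zero_of_additive_of_nearlyNull (Z := fun s t => S s t w - S' s t w) ?_
    ((h.nearlyNull hp hl hn).sub (h'.nearlyNull hp hl hn')) h0 h1 h2)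
  intro a b c ha hab hbc hc
  rw [h.chen_splitSum ha hab hbc hc hne hn, h'.chen_splitSum ha hab hbc hc hne hn',
    splitSum_congr (x := S a b) (x' := S' a b) (y := S b c) (y' := S' b c)
      (fun v hv => ih v.length (by omega) ha hab (hbc.trans hc) v (by omega) (by omega) rfl)
      (fun v hv => ih v.length (by omega) (ha.trans hab) hbc hc v (by omega) (by omega) rfl)]
  ring

end IsPartialExtension

/-- The exponents of the two factors add up to `w.length / r` in each of the `w.length - 1`
splittings. Constants may depend on the degree, so no factorial weights are needed. -/
theorem abs_splitSum_le_control {x y : TensorSeries d} {w : List (Fin (d + 1))}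
    {A B r a b c : ℝ} (hr : 0 < r) (ha : 0 ≤ a) (hb : 0 ≤ b) (hac : a ≤ c) (hbc : b ≤ c)
    (hA : 0 ≤ A) (hB : 0 ≤ B)
    (hx : ∀ v, 1 ≤ v.length → v.length < w.length → |x v| ≤ A * a ^ ((v.length : ℝ) / r))
    (hy : ∀ v, 1 ≤ v.length → v.length < w.length → |y v| ≤ B * b ^ ((v.length : ℝ) / r)) :
    |splitSum x y w| ≤ (w.length - 1 : ℕ) * (A * B) * c ^ ((w.length : ℝ) / r) := by
  rw [mul_assoc]
  refine abs_splitSum_le fun k hk => ?_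
  rw [Finset.mem_Ico] at hk
  have l1 : (w.take k).length = k := by simp; omega
  have l2 : (w.drop k).length = w.length - k := by simp
  have e1 := hx (w.take k) (by omega) (by omega)
  have e2 := hy (w.drop k) (by omega) (by omega)
  rw [l1] at e1
  rw [l2] at e2
  have e3 : (w.length : ℝ) / r = (k : ℝ) / r + ((w.length - k : ℕ) : ℝ) / r := by
    rw [Nat.cast_sub hk.2.le]; ring
  calc _ ≤ (A * a ^ ((k : ℝ) / r)) * (B * b ^ (((w.length - k : ℕ) : ℝ) / r)) := by gcongr
    _ = A * B * (a ^ ((k : ℝ) / r) * b ^ (((w.length - k : ℕ) : ℝ) / r)) := by ring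
    _ ≤ _ := by
      rw [e3]
      gcongr
      exact rpow_mul_rpow_le ha hb hac hbc (by positivity) (by positivity)

/-- Lyons' estimate: an extension obeys the bounds of the rough path in every degree. -/
theorem exists_extension_bound (hp : 1 ≤ p) {r : ℝ} (hr : 0 < r) (hr' : r < ⌊p⌋₊ + 1) (n : ℕ) :
    ∃ C : ℝ, 1 ≤ C ∧ ∀ (X : RoughPath d p T) (ω : ℝ → ℝ → ℝ) (m : ℕ)
      (S : ℝ → ℝ → TensorSeries d), IsControl T ω → Dominates T ⌊p⌋₊ r 1 ω X.toFun →
      X.IsPartialExtension m S → n ≤ m → Dominates T n r C ω S := by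
  induction n with
  | zero => exact ⟨1, le_rfl, fun X ω m S _ _ _ _ s t _ _ _ w h1 h2 => by omega⟩
  | succ n ih =>
    obtain ⟨C, hC1, hC⟩ := ih
    -- The absolute value keeps the constant nonnegative in degrees where the exponent is at most
    -- one, in which the sewing estimate is not used.
    set K := |sewConst (((n + 1 : ℕ) : ℝ) / r)| * (n * (C * C)) with hK
    have hK0 : 0 ≤ K := by positivity
    refine ⟨C + K, by linarith, fun X ω m S hω hX hS hm s t h0 h1 h2 w hw1 hwn => ?_⟩
    have hb := hC X ω m S hω hX hS (by omega)
    have hωp := Real.rpow_nonneg (hω.nonneg s t h0 h1 h2) ((w.length : ℝ) / r)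
    rcases Nat.lt_or_ge n w.length with hl | hl
    swap
    · refine (hb s t h0 h1 h2 w hw1 hl).trans ?_
      gcongr; linarith
    have hwl : w.length = n + 1 := by omega
    rcases Nat.lt_or_ge ⌊p⌋₊ w.length with hpw | hpw
    swap
    · rw [hS.agree s t ⟨h0, h1, h2⟩ w hpw]
      refine (hX s t h0 h1 h2 w hw1 hpw).trans ?_
      gcongr; linarith
    have hne : w ≠ [] := by rw [← List.length_pos_iff]; omega
    have hθ : 1 < (w.length : ℝ) / r := by
      rw [one_lt_div hr]
      refine hr'.trans_le ?_
      exact_mod_cast hpw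
    have hd : DefectLE T (fun s t => S s t w) ω ((w.length : ℝ) / r) (n * (C * C)) := by
      intro a b c ha hab hbc hc
      simp only
      have e : S a c w - S a b w - S b c w = splitSum (S a b) (S b c) w := by
        rw [hS.chen_splitSum ha hab hbc hc hne (by omega)]; ring
      rw [e, show (n : ℝ) = ((w.length - 1 : ℕ) : ℝ) by rw [hwl]; simp]
      refine abs_splitSum_le_control hr (hω.nonneg a b ha hab (hbc.trans hc))
        (hω.nonneg b c (ha.trans hab) hbc hc) (hω.mono ha le_rfl hab hbc hc)
        (hω.mono ha hab hbc le_rfl hc) (by linarith) (by linarith)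
        (fun v hv1 hv2 => hb a b ha hab (hbc.trans hc) v hv1 (by omega))
        (fun v hv1 hv2 => hb b c (ha.trans hab) hbc hc v hv1 (by omega))
    refine (hd.abs_le_of_nearlyNull hω hθ (by positivity) (hS.nearlyNull hp hpw (by omega))
      h0 h1 h2).trans ?_
    gcongr
    rw [hK, hwl]
    have := le_abs_self (sewConst (((n + 1 : ℕ) : ℝ) / r))
    have h5 : 0 ≤ (n : ℝ) * (C * C) := by positivity
    nlinarith

/-- Lyons' continuity estimate: two extensions are as close as the rough paths that they
extend. -/
theorem exists_extension_sub_bound (hp : 1 ≤ p) {r : ℝ} (hr : 0 < r) (hr' : r < ⌊p⌋₊ + 1)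
    (n : ℕ) :
    ∃ C : ℝ, 1 ≤ C ∧ ∀ (X Y : RoughPath d p T) (ω : ℝ → ℝ → ℝ) (ε : ℝ) (m : ℕ)
      (S S' : ℝ → ℝ → TensorSeries d), IsControl T ω → 0 ≤ ε → Dominates T ⌊p⌋₊ r 1 ω X.toFun →
      Dominates T ⌊p⌋₊ r 1 ω Y.toFun → Dominates T ⌊p⌋₊ r ε ω (fun s t => Y.toFun s t - X.toFun s t) →
      X.IsPartialExtension m S → Y.IsPartialExtension m S' → n ≤ m →
      Dominates T n r (C * ε) ω (fun s t => S' s t - S s t) := by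
  induction n with
  | zero => exact ⟨1, le_rfl, fun X Y ω ε m S S' _ _ _ _ _ _ _ _ s t _ _ _ w h1 h2 => by omega⟩
  | succ n ih =>
    obtain ⟨C, hC1, hC⟩ := ih
    obtain ⟨B, hB1, hB⟩ := exists_extension_bound (d := d) (T := T) hp hr hr' n
    set K := |sewConst (((n + 1 : ℕ) : ℝ) / r)| * (2 * (n * (C * B))) with hK
    have hK0 : 0 ≤ K := by positivity
    refine ⟨C + K, by linarith, fun X Y ω ε m S S' hω hε hX hY hXY hS hS' hm s t h0 h1 h2 w
      hw1 hwn => ?_⟩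
    have hb := hB X ω m S hω hX hS (by omega)
    have hb' := hB Y ω m S' hω hY hS' (by omega)
    have hc := hC X Y ω ε m S S' hω hε hX hY hXY hS hS' (by omega)
    have hωp := Real.rpow_nonneg (hω.nonneg s t h0 h1 h2) ((w.length : ℝ) / r)
    have hCK : C * ε ≤ (C + K) * ε := by gcongr; linarith
    rcases Nat.lt_or_ge n w.length with hl | hl
    swap
    · refine (hc s t h0 h1 h2 w hw1 hl).trans ?_
      gcongr
    have hwl : w.length = n + 1 := by omega
    rcases Nat.lt_or_ge ⌊p⌋₊ w.length with hpw | hpw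
    swap
    · have := hXY s t h0 h1 h2 w hw1 hpw
      simp only [Pi.sub_apply] at this ⊢
      rw [hS.agree s t ⟨h0, h1, h2⟩ w hpw, hS'.agree s t ⟨h0, h1, h2⟩ w hpw]
      refine this.trans ?_
      gcongr
      refine le_trans ?_ hCK
      nlinarith
    have hne : w ≠ [] := by rw [← List.length_pos_iff]; omega
    have hθ : 1 < (w.length : ℝ) / r := by
      rw [one_lt_div hr]
      refine hr'.trans_le ?_
      exact_mod_cast hpw
    have hd : DefectLE T (fun s t => S' s t w - S s t w) ω ((w.length : ℝ) / r)
        (2 * (n * (C * B)) * ε) := by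
      intro a b c ha hab hbc hcT
      simp only
      -- The defect of the difference is bilinear in lower degrees with one factor always a
      -- difference, hence linear in ε.
      have e : S' a c w - S a c w - (S' a b w - S a b w) - (S' b c w - S b c w)
          = splitSum (S' a b - S a b) (S' b c) w + splitSum (S a b) (S' b c - S b c) w := by
        rw [hS.chen_splitSum ha hab hbc hcT hne (by omega),
          hS'.chen_splitSum ha hab hbc hcT hne (by omega), ← splitSum_sub]
        ring
      have n1 := hω.nonneg a b ha hab (hbc.trans hcT)
      have n2 := hω.nonneg b c (ha.trans hab) hbc hcT
      have m1 := hω.mono ha le_rfl hab hbc hcT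
      have m2 := hω.mono ha hab hbc le_rfl hcT
      have i1 := abs_splitSum_le_control (w := w) hr n1 n2 m1 m2 (A := C * ε) (B := B)
        (by positivity) (by linarith)
        (fun v hv1 hv2 => hc a b ha hab (hbc.trans hcT) v hv1 (by omega))
        (fun v hv1 hv2 => hb' b c (ha.trans hab) hbc hcT v hv1 (by omega))
      have i2 := abs_splitSum_le_control (w := w) hr n1 n2 m1 m2 (A := B) (B := C * ε)
        (by linarith) (by positivity)
        (fun v hv1 hv2 => hb a b ha hab (hbc.trans hcT) v hv1 (by omega))
        (fun v hv1 hv2 => hc b c (ha.trans hab) hbc hcT v hv1 (by omega))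
      rw [e]
      refine (abs_add_le _ _).trans ((add_le_add i1 i2).trans_eq ?_)
      rw [show ((w.length - 1 : ℕ) : ℝ) = n by rw [hwl]; simp]
      ring
    refine (hd.abs_le_of_nearlyNull hω hθ (by positivity)
      ((hS'.nearlyNull hp hpw (by omega)).sub (hS.nearlyNull hp hpw (by omega)))
      h0 h1 h2).trans ?_
    refine mul_le_mul_of_nonneg_right ?_ hωp
    rw [hK, hwl]
    have := le_abs_self (sewConst (((n + 1 : ℕ) : ℝ) / r))
    have h5 : 0 ≤ 2 * ((n : ℝ) * (C * B)) * ε := by positivity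
    have h6 : 0 ≤ C * ε := by positivity
    nlinarith

/-- The control of a rough path. -/
def control (r : ℝ) (X : RoughPath d p T) (s t : ℝ) : ℝ :=
  ∑ i ∈ Finset.Icc 1 ⌊p⌋₊, levelControl r i X.toFun s t

/-- The factor `c ^ (r / i)` is what becomes c, in every degree i, once the control is raised to the
power `i / r`. -/
theorem dominates_of_levelControl_le {r c : ℝ} (hr : 0 < r) (hc : 0 < c) {L : ℕ}
    {ω : ℝ → ℝ → ℝ} {Z : ℝ → ℝ → TensorSeries d} (hω : IsControl T ω)
    (hfin : ∀ i, 1 ≤ i → i ≤ L → levelVariation r T i Z < ⊤)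
    (h : ∀ i, 1 ≤ i → i ≤ L → ∀ s t, 0 ≤ s → s ≤ t → t ≤ T →
      levelControl r i Z s t ≤ c ^ (r / (i : ℝ)) * ω s t) :
    Dominates T L r c ω Z := by
  intro s t h0 h1 h2 w hw1 hwL
  have hn : (0 : ℝ) < w.length := by exact_mod_cast hw1
  refine (abs_apply_le_norm_tensorLevel _ _).trans
    ((norm_le_levelControl_rpow hr hw1 (hfin _ hw1 hwL) h0 h1 h2).trans ?_)
  refine (Real.rpow_le_rpow ((isControl_levelControl (hfin _ hw1 hwL)).nonneg s t h0 h1 h2)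
    (h _ hw1 hwL s t h0 h1 h2) (by positivity)).trans_eq ?_
  rw [Real.mul_rpow (by positivity) (hω.nonneg s t h0 h1 h2), ← Real.rpow_mul hc.le,
    div_mul_div_cancel₀ hn.ne', div_self hr.ne', Real.rpow_one]

theorem isControl_control (hp : 1 ≤ p) {r : ℝ} (hr : p ≤ r) (X : RoughPath d p T) :
    IsControl T (X.control r) :=
  IsControl.sum _ fun i hi => by
    rw [Finset.mem_Icc] at hi
    exact isControl_levelControl (levelVariation_lt_top_of_le (by linarith) hr hi.1
      (X.finite_variation i hi.1 hi.2))

theorem levelControl_le_control (r : ℝ) (X : RoughPath d p T) {i : ℕ} (h1 : 1 ≤ i)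
    (h2 : i ≤ ⌊p⌋₊) (s t : ℝ) : levelControl r i X.toFun s t ≤ X.control r s t :=
  Finset.single_le_sum (f := fun i => levelControl r i X.toFun s t)
    (fun _ _ => ENNReal.toReal_nonneg) (Finset.mem_Icc.2 ⟨h1, h2⟩)

theorem dominates_control (hp : 1 ≤ p) {r : ℝ} (hr : p ≤ r) (X : RoughPath d p T) :
    Dominates T ⌊p⌋₊ r 1 (X.control r) X.toFun :=
  dominates_of_levelControl_le (by linarith) one_pos (isControl_control hp hr X)
    (fun i h1 h2 => levelVariation_lt_top_of_le (by linarith) hr h1 (X.finite_variation i h1 h2))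
    fun i h1 h2 s t _ _ _ => by
      rw [Real.one_rpow, one_mul]; exact levelControl_le_control r X h1 h2 s t

theorem vanishesAtDiagonal_control (hp : 1 ≤ p) {r : ℝ} (hr : p < r) (X : RoughPath d p T) :
    VanishesAtDiagonal T (X.control r) := by
  have h : ∀ i ∈ Finset.Icc 1 ⌊p⌋₊, VanishesAtDiagonal T (levelControl r i X.toFun) := by
    intro i hi
    rw [Finset.mem_Icc] at hi
    refine vanishesAtDiagonal_levelControl (by linarith) hr hi.1 (X.finite_variation i hi.1 hi.2)
      (vanishesAtDiagonal_norm_tensorLevel fun w hw => ?_)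
    exact X.isPartialExtension_self.vanishesAtDiagonal
      (by rw [← List.length_pos_iff]; omega) (by omega)
  unfold control
  generalize Finset.Icc 1 ⌊p⌋₊ = A at h
  induction A using Finset.induction_on with
  | empty => exact fun η hη => ⟨1, one_pos, fun s t _ _ _ _ => by simpa using hη.le⟩
  | insert i A hi ih =>
    intro η hη
    obtain ⟨δ, hδ, D⟩ := h i (by simp) (η / 2) (by positivity)
    obtain ⟨δ', hδ', D'⟩ := ih (fun j hj => h j (by simp [hj])) (η / 2) (by positivity)
    refine ⟨min δ δ', lt_min hδ hδ', fun s t h0 h1 h2 h3 => ?_⟩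
    have a := D s t h0 h1 h2 (h3.trans_le (min_le_left _ _))
    have b := D' s t h0 h1 h2 (h3.trans_le (min_le_right _ _))
    simp only [Finset.sum_insert hi]
    exact (abs_add_le _ _).trans (by linarith)

/-- Associativity of the tensor product, with base point 0: the germ built from lower degrees has,
up to sign, exactly the defect that Chen's relation prescribes for the next degree. -/
theorem germ_defect {X : RoughPath d p T} {n : ℕ} {S : ℝ → ℝ → TensorSeries d}
    (hS : X.IsPartialExtension n S) {w : List (Fin (d + 1))} (hw : w.length = n + 1) {s u t : ℝ}
    (h0 : 0 ≤ s) (h1 : s ≤ u) (h2 : u ≤ t) (h3 : t ≤ T) :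
    splitSum (S 0 s) (S s t) w - splitSum (S 0 s) (S s u) w - splitSum (S 0 u) (S u t) w
      = - splitSum (S s u) (S u t) w := by
  have hne : w ≠ [] := by rw [← List.length_pos_iff]; omega
  have := splitSum_cocycle hne (hS.apply_nil le_rfl h0 (h1.trans (h2.trans h3)))
    (hS.apply_nil h0 h1 (h2.trans h3)) (hS.apply_nil (h0.trans h1) h2 h3)
    (ab := S 0 u) (bc := S s t)
    (fun v hv => hS.chen 0 s u le_rfl h0 h1 (h2.trans h3) v (by omega))
    (fun v hv => hS.chen s u t h0 h1 h2 h3 v (by omega))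
  linarith

/-- The next degree is a sewn additive function minus the germ `splitSum (S 0 s) (S s t)`, whose
defect supplies Chen's term. -/
theorem exists_isPartialExtension_succ (hp : 1 ≤ p) {X : RoughPath d p T} {n : ℕ}
    (hpn : ⌊p⌋₊ ≤ n) {S : ℝ → ℝ → TensorSeries d} (hS : X.IsPartialExtension n S) :
    ∃ S', X.IsPartialExtension (n + 1) S' := by
  have hp0 : 0 < p := by linarith
  have hpL : p < ⌊p⌋₊ + 1 := Nat.lt_floor_add_one p
  -- The p'-control tends to zero at the diagonal, which convergence and continuity require; the
  -- p-control gives the sharp bound for finite p-variation.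
  obtain ⟨p', hpp', hp'L⟩ := exists_between hpL
  have hp'0 : 0 < p' := by linarith
  have hLn : (⌊p⌋₊ : ℝ) + 1 ≤ ((n + 1 : ℕ) : ℝ) := by exact_mod_cast Nat.succ_le_succ hpn
  have hdef : ∀ r, p ≤ r → r < ⌊p⌋₊ + 1 → ∃ D, 0 ≤ D ∧ ∀ w : List (Fin (d + 1)),
      w.length = n + 1 → DefectLE T (fun s t => splitSum (S 0 s) (S s t) w) (X.control r)
        (((n + 1 : ℕ) : ℝ) / r) D := by
    intro r hr hrL
    obtain ⟨C, hC1, hC⟩ := exists_extension_bound (d := d) (T := T) hp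
      (show 0 < r by linarith) hrL n
    have hω := isControl_control hp hr X
    have hb := hC X _ n S hω (dominates_control hp hr X) hS le_rfl
    refine ⟨n * (C * C), by positivity, fun w hw a b c ha hab hbc hc => ?_⟩
    simp only
    rw [germ_defect hS hw ha hab hbc hc, abs_neg, ← hw,
      show (n : ℝ) = ((w.length - 1 : ℕ) : ℝ) by rw [hw]; simp]
    exact abs_splitSum_le_control (by linarith) (hω.nonneg a b ha hab (hbc.trans hc))
        (hω.nonneg b c (ha.trans hab) hbc hc) (hω.mono ha le_rfl hab hbc hc)
        (hω.mono ha hab hbc le_rfl hc) (by linarith) (by linarith)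
        (fun v hv1 hv2 => hb a b ha hab (hbc.trans hc) v hv1 (by omega))
        (fun v hv1 hv2 => hb b c (ha.trans hab) hbc hc v hv1 (by omega))
  obtain ⟨D, hD0, hD⟩ := hdef p le_rfl hpL
  obtain ⟨D', hD'0, hD'⟩ := hdef p' hpp'.le hp'L
  have hθ : 1 < ((n + 1 : ℕ) : ℝ) / p := by rw [one_lt_div hp0]; linarith
  have hθ' : 1 < ((n + 1 : ℕ) : ℝ) / p' := by rw [one_lt_div hp'0]; linarith
  have hω := isControl_control hp le_rfl X
  have hω' := isControl_control hp hpp'.le X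
  have hv' := vanishesAtDiagonal_control hp hpp' X
  have hsew := fun (w : List (Fin (d + 1))) (hw : w.length = n + 1) =>
    exists_sewing (hD' w hw) hω' hθ' hD'0 hv'
  choose I hIadd hIest using hsew
  set S' : ℝ → ℝ → TensorSeries d := fun s t w =>
    if hw : w.length = n + 1 then I w hw s t - splitSum (S 0 s) (S s t) w else S s t w with hS'def
  have hlow : ∀ s t w, w.length ≤ n → S' s t w = S s t w := fun s t w hw => by
    simp only [hS'def, show ¬ w.length = n + 1 by omega, dite_false]
  have htop : ∀ s t w (hw : w.length = n + 1),
      S' s t w = I w hw s t - splitSum (S 0 s) (S s t) w := fun s t w hw => by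
    simp only [hS'def, hw, dite_true]
  refine ⟨S', ?_, ?_, ?_, ?_⟩
  · intro s t hst w hw
    rw [hlow s t w (by omega), hS.agree s t hst w hw]
  · intro w hw
    rcases Nat.lt_or_ge n w.length with hl | hl
    swap
    · exact (hS.continuousOn w hl).congr fun q _ => hlow _ _ _ hl
    have hw : w.length = n + 1 := by omega
    have hmaps : Set.MapsTo (fun q : ℝ × ℝ => ((0 : ℝ), q.1)) (timeSimplex T) (timeSimplex T) :=
      fun q hq => ⟨le_rfl, hq.1, hq.2.1.trans hq.2.2⟩
    have hΞ : ContinuousOn (fun q : ℝ × ℝ => splitSum (S 0 q.1) (S q.1 q.2) w)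
        (timeSimplex T) := by
      unfold splitSum
      refine continuousOn_finsetSum _ fun k hk => ?_
      rw [Finset.mem_Ico] at hk
      refine ContinuousOn.mul ?_ (hS.continuousOn _ (by simp; omega))
      exact (hS.continuousOn (w.take k) (by simp; omega)).comp
        (f := fun q : ℝ × ℝ => ((0 : ℝ), q.1)) (by fun_prop) hmaps
    have hΞv : VanishesAtDiagonal T fun s t => splitSum (S 0 s) (S s t) w :=
      vanishesAtDiagonal_of_continuousOn hΞ fun s h0 h1 =>
        (hD' w hw).self_eq_zero hω' hθ' h0 h1
    have hIv : VanishesAtDiagonal T (I w hw) := by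
      intro η hη
      obtain ⟨δ, hδ, H⟩ := hΞv (η / 2) (by positivity)
      set M := sewConst (((n + 1 : ℕ) : ℝ) / p') * D' * X.control p' 0 T with hM
      have hsc := sewConst_pos hθ'
      obtain ⟨δ', hδ', H'⟩ := hv'.rpow_le hω' hθ' (η := η / 2 / (|M| + 1)) (by positivity)
      refine ⟨min δ δ', lt_min hδ hδ', fun s t h0 h1 h2 h3 => ?_⟩
      have a := H s t h0 h1 h2 (h3.trans_le (min_le_left _ _))
      have b := H' s t h0 h1 h2 (h3.trans_le (min_le_right _ _))
      have c := hIest w hw _ _ _ hω' hθ' hD'0 (hD' w hw) s t h0 h1 h2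
      have hmono := hω'.mono le_rfl h0 h1 h2 le_rfl
      have e : sewConst (((n + 1 : ℕ) : ℝ) / p') * D' * X.control p' s t ^ (((n + 1 : ℕ) : ℝ) / p')
          ≤ η / 2 := by
        calc _ ≤ sewConst (((n + 1 : ℕ) : ℝ) / p') * D' *
              (η / 2 / (|M| + 1) * X.control p' 0 T) := by
                gcongr
                exact b.trans (by gcongr)
          _ = η / 2 * M / (|M| + 1) := by rw [hM]; ring
          _ ≤ η / 2 := by
            rw [div_le_iff₀ (by positivity)]
            have := le_abs_self M
            nlinarith
      have := abs_sub_abs_le_abs_sub (I w hw s t) (splitSum (S 0 s) (S s t) w)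
      linarith
    have hI0 : ContinuousOn (fun t => I w hw 0 t) (Set.Icc 0 T) := by
      rw [Metric.continuousOn_iff]
      intro t ht ε hε
      obtain ⟨δ, hδ, H⟩ := hIv (ε / 2) (by positivity)
      refine ⟨δ, hδ, fun s hs hd => ?_⟩
      rw [Real.dist_eq] at hd ⊢
      refine lt_of_le_of_lt ?_ (half_lt_self hε)
      rcases le_total s t with h | h
      · have := H s t hs.1 h ht.2 (by rw [abs_sub_comm] at hd; exact (le_abs_self _).trans_lt hd)
        rw [abs_sub_comm, hIadd w hw 0 s t le_rfl hs.1 h ht.2]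
        simpa using this
      · have := H t s ht.1 h hs.2 ((le_abs_self _).trans_lt hd)
        rw [hIadd w hw 0 t s le_rfl ht.1 h hs.2]
        simpa using this
    -- Additivity reduces joint continuity to continuity of the sewn function started at 0.
    have hIc : ContinuousOn (fun q : ℝ × ℝ => I w hw 0 q.2 - I w hw 0 q.1) (timeSimplex T) := by
      refine ContinuousOn.sub ?_ ?_
      · exact hI0.comp continuousOn_snd fun q hq => ⟨hq.1.trans hq.2.1, hq.2.2⟩
      · exact hI0.comp continuousOn_fst fun q hq => ⟨hq.1, hq.2.1.trans hq.2.2⟩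
    refine (hIc.sub hΞ).congr fun q hq => ?_
    have := hIadd w hw 0 q.1 q.2 le_rfl hq.1 hq.2.1 hq.2.2
    rw [htop _ _ _ hw, Pi.sub_apply]
    linarith
  · intro s u t h0 h1 h2 h3 w hw
    rcases Nat.lt_or_ge n w.length with hl | hl
    swap
    · rw [hlow _ _ _ hl, hS.chen s u t h0 h1 h2 h3 w hl]
      exact tensorMul_congr (fun v hv => (hlow _ _ _ (by omega)).symm)
        (fun v hv => (hlow _ _ _ (by omega)).symm)
    have hw : w.length = n + 1 := by omega
    have hne : w ≠ [] := by rw [← List.length_pos_iff]; omega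
    rw [tensorMul_eq_splitSum _ _ hne, hlow s u [] (by simp), hlow u t [] (by simp),
      hS.apply_nil h0 h1 (h2.trans h3), hS.apply_nil (h0.trans h1) h2 h3,
      splitSum_congr (x := S' s u) (x' := S s u) (y := S' u t) (y' := S u t)
        (fun v hv => hlow _ _ _ (by omega)) (fun v hv => hlow _ _ _ (by omega)),
      htop _ _ _ hw, htop _ _ _ hw, htop _ _ _ hw, hIadd w hw s u t h0 h1 h2 h3]
    have := germ_defect hS hw h0 h1 h2 h3
    linarith
  · intro i hi1 hi2
    rcases Nat.lt_or_ge n i with hl | hl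
    swap
    · have : levelVariation p T i S' = levelVariation p T i S := by
        have : ∀ s t, tensorLevel i (S' s t) = tensorLevel i (S s t) := fun s t => by
          ext v
          exact hlow s t _ (by simpa using hl)
        simp only [levelVariation, this]
      rw [this]
      exact hS.finite_variation i hi1 hl
    have hin : i = n + 1 := by omega
    subst hin
    have hsc := sewConst_pos hθ
    refine levelVariation_lt_top_of_bound (B := sewConst (((n + 1 : ℕ) : ℝ) / p) * D) hω hp0 hi1
      (by positivity) fun s t h0 h1 h2 w hw => ?_
    rw [htop _ _ _ hw]
    -- The sewing was built with the p'-control but is estimated with the p-control.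
    exact hIest w hw _ _ _ hω hθ hD0 (hD w hw) s t h0 h1 h2

theorem exists_isPartialExtension (hp : 1 ≤ p) (X : RoughPath d p T) (k : ℕ) :
    ∃ S, X.IsPartialExtension (⌊p⌋₊ + k) S := by
  induction k with
  | zero => exact ⟨_, X.isPartialExtension_self⟩
  | succ k ih =>
    obtain ⟨S, hS⟩ := ih
    exact exists_isPartialExtension_succ hp (Nat.le_add_right _ _) hS

/-- Existence of Lyons' extension. -/
theorem exists_isExtension (hp : 1 ≤ p) (X : RoughPath d p T) : ∃ S, X.IsExtension S := by
  choose E hE using exists_isPartialExtension hp X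
  have heq : ∀ n s t, 0 ≤ s → s ≤ t → t ≤ T → ∀ w : List (Fin (d + 1)), w.length ≤ n →
      E w.length s t w = E n s t w := fun n s t h0 h1 h2 w hw =>
    (hE w.length).unique (hE n) hp h0 h1 h2 w (by omega) (by omega)
  -- Each coefficient is read from a partial extension reaching its own degree; uniqueness makes
  -- these choices consistent.
  refine ⟨fun s t w => E w.length s t w, ?_, ?_, ?_, ?_⟩
  · exact fun s t hst w hw => (hE _).agree s t hst w hw
  · exact fun w => (hE w.length).continuousOn w (by omega)
  · intro s u t h0 h1 h2 h3
    funext w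
    rw [(hE w.length).chen s u t h0 h1 h2 h3 w (by omega)]
    exact tensorMul_congr (fun v hv => (heq _ s u h0 h1 (h2.trans h3) v hv).symm)
      (fun v hv => (heq _ u t (h0.trans h1) h2 h3 v hv).symm)
  · intro i hi
    have : levelVariation p T i (fun s t w => E w.length s t w) = levelVariation p T i (E i) := by
      simp only [levelVariation, tensorLevel, List.length_ofFn]
    rw [this]
    exact (hE i).finite_variation i hi (by omega)

/-- Uniqueness of Lyons' extension: every extension computes the signature. -/
theorem IsExtension.signature_eq {X : RoughPath d p T} {S : ℝ → ℝ → TensorSeries d}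
    (h : X.IsExtension S) (hp : 1 ≤ p) (hT : 0 ≤ T) : X.signature = S 0 T := by
  have hex : ∃ S, X.IsExtension S := ⟨S, h⟩
  rw [signature, dif_pos hex]
  funext w
  exact (hex.choose_spec.isPartialExtension w.length).unique (h.isPartialExtension w.length) hp
    le_rfl hT le_rfl w le_rfl le_rfl

end RoughPath

/-! ### Growth and continuity of the signature. -/

namespace RoughPath

variable {d : ℕ} {p T : ℝ}

theorem levelControl_le_pVariation (X : RoughPath d p T) {i : ℕ} (hi : i ∈ Finset.Icc 1 ⌊p⌋₊) :
    levelControl p i X.toFun 0 T ≤ X.pVariation := by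
  rw [levelControl_full, pVariation]
  refine ENNReal.toReal_mono ?_ (le_iSup₂ (f := fun i (_ : i ∈ Finset.Icc 1 ⌊p⌋₊) =>
    levelVariation p T i X.toFun) i hi)
  have hfin : ∑ i ∈ Finset.Icc 1 ⌊p⌋₊, levelVariation p T i X.toFun < ⊤ :=
    ENNReal.sum_lt_top.2 fun i hi =>
      X.finite_variation i (Finset.mem_Icc.1 hi).1 (Finset.mem_Icc.1 hi).2
  exact ne_top_of_le_ne_top hfin.ne (iSup₂_le fun i hi =>
    Finset.single_le_sum (f := fun i => levelVariation p T i X.toFun) (fun _ _ => zero_le) hi)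

theorem pVariation_nonneg (X : RoughPath d p T) : 0 ≤ X.pVariation := ENNReal.toReal_nonneg

theorem control_le_pVariation (X : RoughPath d p T) :
    X.control p 0 T ≤ ⌊p⌋₊ * X.pVariation := by
  have := Finset.sum_le_card_nsmul (Finset.Icc 1 ⌊p⌋₊) (fun i => levelControl p i X.toFun 0 T)
    X.pVariation fun i hi => X.levelControl_le_pVariation hi
  simpa [control] using this

/-- Lyons' estimate with the path's own control, whose total is at most `⌊p⌋` times the size. Adding
one to the size makes the base at least one, so the exponent `w.length / p` can be raised to an
integer. -/
theorem exists_signature_growth (hp : 1 ≤ p) (hT : 0 ≤ T) (w : List (Fin (d + 1))) :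
    ∃ C : ℝ, 0 ≤ C ∧ ∀ X : RoughPath d p T,
      |X.signature w| ≤ C * (1 + X.pVariation) ^ w.length := by
  obtain ⟨C, hC1, hC⟩ := exists_extension_bound (d := d) (T := T) hp (r := p) (by linarith)
    (Nat.lt_floor_add_one p) w.length
  refine ⟨C * (1 + ⌊p⌋₊) ^ w.length, by positivity, fun X => ?_⟩
  obtain ⟨S, hS⟩ := X.exists_isExtension hp
  have hX := X.pVariation_nonneg
  rw [hS.signature_eq hp hT, mul_assoc, ← mul_pow]
  rcases Nat.eq_zero_or_pos w.length with h | h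
  · rw [List.length_eq_zero_iff] at h
    subst h
    rw [(hS.isPartialExtension 0).apply_nil le_rfl hT le_rfl]
    simpa using hC1
  refine (hC X _ _ S (isControl_control hp le_rfl X) (dominates_control hp le_rfl X)
    (hS.isPartialExtension w.length) le_rfl 0 T le_rfl hT le_rfl w h le_rfl).trans ?_
  have hω := (isControl_control hp le_rfl X).nonneg 0 T le_rfl hT le_rfl
  have hle := X.control_le_pVariation
  gcongr
  have e1 : X.control p 0 T ≤ (1 + ⌊p⌋₊) * (1 + X.pVariation) := by
    have : (0 : ℝ) ≤ ⌊p⌋₊ := by positivity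
    nlinarith
  have e2 : 1 ≤ (1 + (⌊p⌋₊ : ℝ)) * (1 + X.pVariation) := by
    have : (0 : ℝ) ≤ ⌊p⌋₊ := by positivity
    nlinarith
  calc X.control p 0 T ^ ((w.length : ℝ) / p)
      ≤ ((1 + (⌊p⌋₊ : ℝ)) * (1 + X.pVariation)) ^ ((w.length : ℝ) / p) := by gcongr
    _ ≤ ((1 + (⌊p⌋₊ : ℝ)) * (1 + X.pVariation)) ^ (w.length : ℝ) :=
        Real.rpow_le_rpow_of_exponent_le e2 (div_le_self (by positivity) hp)
    _ = _ := by rw [Real.rpow_natCast]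

theorem levelVariation_sub_le {X Y : RoughPath d p T} {ε : ℝ} (hε : 0 < ε)
    (h : edist X Y ≤ ENNReal.ofReal ε) {i : ℕ} (hi : i ∈ Finset.Icc 1 ⌊p⌋₊) :
    levelVariation p T i (fun s t => Y.toFun s t - X.toFun s t)
      ≤ ENNReal.ofReal (ε ^ (p / (i : ℝ))) := by
  have hr : 0 < p / (i : ℝ) := lt_of_lt_of_le one_pos (one_le_div_of_mem hi)
  have h1 := (le_iSup₂ (f := fun i (_ : i ∈ Finset.Icc 1 ⌊p⌋₊) =>
    levelVariation p T i (fun s t => X.toFun s t - Y.toFun s t) ^ (1 / (p / (i : ℝ)))) i hi).trans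
    ((edist_def X Y).symm.le.trans h)
  rw [one_div, ENNReal.rpow_inv_le_iff hr, levelVariation_sub_comm] at h1
  rwa [← ENNReal.ofReal_rpow_of_nonneg hε.le hr.le]

/-- A bound for the control of the rough paths at distance at most one from `X`. -/
def neighborBound (X : RoughPath d p T) (i : ℕ) : ℝ≥0∞ :=
  (1 + levelVariation p T i X.toFun ^ (1 / (p / (i : ℝ)))) ^ (p / (i : ℝ))

theorem neighborBound_ne_top (X : RoughPath d p T) {i : ℕ} (hi : i ∈ Finset.Icc 1 ⌊p⌋₊) :
    X.neighborBound i ≠ ⊤ := by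
  have hr : 0 < p / (i : ℝ) := lt_of_lt_of_le one_pos (one_le_div_of_mem hi)
  have hi' := Finset.mem_Icc.1 hi
  refine ENNReal.rpow_ne_top_of_nonneg hr.le (ENNReal.add_ne_top.2 ⟨ENNReal.one_ne_top, ?_⟩)
  exact ENNReal.rpow_ne_top_of_nonneg (by positivity) (X.finite_variation i hi'.1 hi'.2).ne

theorem levelVariation_le_neighborBound {X Y : RoughPath d p T} (h : edist X Y ≤ 1) {i : ℕ}
    (hi : i ∈ Finset.Icc 1 ⌊p⌋₊) : levelVariation p T i Y.toFun ≤ X.neighborBound i := by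
  have hr1 := one_le_div_of_mem hi
  have hr : 0 < p / (i : ℝ) := lt_of_lt_of_le one_pos hr1
  -- With zero as third functional, Minkowski's inequality bounds Y by its distance to X plus the
  -- size of X.
  have h1 := levelVariation_triangle (T := T) i hr1 Y.toFun X.toFun (fun _ _ => 0)
  simp only [sub_zero] at h1
  have h2 := levelVariation_sub_le one_pos (by simpa using h) hi
  rw [Real.one_rpow, ENNReal.ofReal_one] at h2
  have h3 : levelVariation p T i (fun s t => Y.toFun s t - X.toFun s t) ^ (1 / (p / (i : ℝ)))
      ≤ 1 := ENNReal.rpow_le_one h2 (by positivity)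
  have h4 := h1.trans (add_le_add_left h3 _)
  rw [one_div, ENNReal.rpow_inv_le_iff hr] at h4
  rw [neighborBound, one_div]
  exact h4

/-- The continuity estimate for extensions needs one control for X, Y and their difference whose
total is bounded in terms of X alone; the sum of the three controls below serves. -/
theorem exists_signature_lipschitz (hp : 1 ≤ p) (hT : 0 ≤ T) (w : List (Fin (d + 1)))
    (X : RoughPath d p T) :
    ∃ M : ℝ, 0 ≤ M ∧ ∀ (Y : RoughPath d p T) (ε : ℝ), 0 < ε → ε ≤ 1 →
      edist X Y ≤ ENNReal.ofReal ε → |Y.signature w - X.signature w| ≤ M * ε := by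
  have hp0 : 0 < p := by linarith
  obtain ⟨C, hC1, hC⟩ := exists_extension_sub_bound (d := d) (T := T) hp (r := p) hp0
    (Nat.lt_floor_add_one p) w.length
  set M := X.control p 0 T + ∑ i ∈ Finset.Icc 1 ⌊p⌋₊, (X.neighborBound i).toReal + ⌊p⌋₊ with hM
  have hM0 : 0 ≤ M := by
    have := (isControl_control hp le_rfl X).nonneg 0 T le_rfl hT le_rfl
    have : 0 ≤ ∑ i ∈ Finset.Icc 1 ⌊p⌋₊, (X.neighborBound i).toReal :=
      Finset.sum_nonneg fun _ _ => ENNReal.toReal_nonneg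
    positivity
  refine ⟨C * M ^ ((w.length : ℝ) / p), by positivity, fun Y ε hε hε1 hXY => ?_⟩
  obtain ⟨S, hS⟩ := X.exists_isExtension hp
  obtain ⟨S', hS'⟩ := Y.exists_isExtension hp
  rw [hS.signature_eq hp hT, hS'.signature_eq hp hT]
  rcases Nat.eq_zero_or_pos w.length with h | h
  · rw [List.length_eq_zero_iff] at h
    subst h
    rw [(hS.isPartialExtension 0).apply_nil le_rfl hT le_rfl,
      (hS'.isPartialExtension 0).apply_nil le_rfl hT le_rfl, sub_self, abs_zero]
    positivity
  set Z : ℝ → ℝ → TensorSeries d := fun s t => Y.toFun s t - X.toFun s t with hZ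
  have hZv : ∀ i ∈ Finset.Icc 1 ⌊p⌋₊, levelVariation p T i Z
      ≤ ENNReal.ofReal (ε ^ (p / (i : ℝ))) := fun i hi => levelVariation_sub_le hε hXY hi
  have hZfin : ∀ i, 1 ≤ i → i ≤ ⌊p⌋₊ → levelVariation p T i Z < ⊤ := fun i h1 h2 =>
    (hZv i (Finset.mem_Icc.2 ⟨h1, h2⟩)).trans_lt ENNReal.ofReal_lt_top
  set ωX := X.control p
  set ωY := Y.control p
  -- Rescaling by `ε ^ (-p / i)` makes the difference dominated with factor ε, while closeness of
  -- the paths keeps the total of this control at most `⌊p⌋`.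
  set ωZ : ℝ → ℝ → ℝ := fun s t => ∑ i ∈ Finset.Icc 1 ⌊p⌋₊,
    (ε ^ (p / (i : ℝ)))⁻¹ * levelControl p i Z s t with hωZ
  have cX : IsControl T ωX := isControl_control hp le_rfl X
  have cY : IsControl T ωY := isControl_control hp le_rfl Y
  have cZ : IsControl T ωZ := IsControl.sum _ fun i hi =>
    (isControl_levelControl (hZfin i (Finset.mem_Icc.1 hi).1 (Finset.mem_Icc.1 hi).2)).const_mul
      (by positivity)
  have cω := (cX.add cY).add cZ
  have dX : Dominates T ⌊p⌋₊ p 1 (fun s t => ωX s t + ωY s t + ωZ s t) X.toFun :=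
    dominates_of_levelControl_le hp0 one_pos cω X.finite_variation
      fun i h1 h2 s t h3 h4 h5 => by
        rw [Real.one_rpow, one_mul]
        have := levelControl_le_control p X h1 h2 s t
        have := cY.nonneg s t h3 h4 h5
        have := cZ.nonneg s t h3 h4 h5
        linarith
  have dY : Dominates T ⌊p⌋₊ p 1 (fun s t => ωX s t + ωY s t + ωZ s t) Y.toFun :=
    dominates_of_levelControl_le hp0 one_pos cω Y.finite_variation
      fun i h1 h2 s t h3 h4 h5 => by
        rw [Real.one_rpow, one_mul]
        have := levelControl_le_control p Y h1 h2 s t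
        have := cX.nonneg s t h3 h4 h5
        have := cZ.nonneg s t h3 h4 h5
        linarith
  have dZ : Dominates T ⌊p⌋₊ p ε (fun s t => ωX s t + ωY s t + ωZ s t) Z :=
    dominates_of_levelControl_le hp0 hε cω hZfin
      fun i h1 h2 s t h3 h4 h5 => by
        have e1 : (ε ^ (p / (i : ℝ)))⁻¹ * levelControl p i Z s t ≤ ωZ s t :=
          Finset.single_le_sum
            (f := fun i : ℕ => (ε ^ (p / (i : ℝ)))⁻¹ * levelControl p i Z s t)
            (fun j _ => mul_nonneg (by positivity) ENNReal.toReal_nonneg)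
            (Finset.mem_Icc.2 ⟨h1, h2⟩)
        have := cX.nonneg s t h3 h4 h5
        have := cY.nonneg s t h3 h4 h5
        rw [← inv_mul_le_iff₀ (by positivity)]
        linarith
  have hfin := hC X Y _ ε w.length S S' cω hε.le dX dY dZ (hS.isPartialExtension _)
    (hS'.isPartialExtension _) le_rfl 0 T le_rfl hT le_rfl w h le_rfl
  have bY : ωY 0 T ≤ ∑ i ∈ Finset.Icc 1 ⌊p⌋₊, (X.neighborBound i).toReal := by
    refine Finset.sum_le_sum fun i hi => ?_
    rw [levelControl_full]
    refine ENNReal.toReal_mono (X.neighborBound_ne_top hi) (levelVariation_le_neighborBound ?_ hi)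
    exact hXY.trans (by simpa using ENNReal.ofReal_le_ofReal hε1)
  have bZ : ωZ 0 T ≤ ⌊p⌋₊ := by
    have : ∀ i ∈ Finset.Icc 1 ⌊p⌋₊, (ε ^ (p / (i : ℝ)))⁻¹ * levelControl p i Z 0 T ≤ 1 := by
      intro i hi
      have h1 := ENNReal.toReal_mono ENNReal.ofReal_ne_top (hZv i hi)
      rw [← levelControl_full, ENNReal.toReal_ofReal (by positivity)] at h1
      rw [inv_mul_le_iff₀ (by positivity), mul_one]
      exact h1
    simpa [hωZ] using Finset.sum_le_card_nsmul _ _ _ this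
  refine hfin.trans ?_
  have e1 : ωX 0 T + ωY 0 T + ωZ 0 T ≤ M := by linarith
  have e0 := cω.nonneg 0 T le_rfl hT le_rfl
  have e2 : (ωX 0 T + ωY 0 T + ωZ 0 T) ^ ((w.length : ℝ) / p) ≤ M ^ ((w.length : ℝ) / p) := by
    gcongr
  calc C * ε * (ωX 0 T + ωY 0 T + ωZ 0 T) ^ ((w.length : ℝ) / p)
      ≤ C * ε * M ^ ((w.length : ℝ) / p) := by gcongr
    _ = _ := by ring

theorem continuous_signature (hp : 1 ≤ p) (hT : 0 ≤ T) (w : List (Fin (d + 1))) :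
    Continuous fun X : RoughPath d p T => X.signature w := by
  rw [continuous_iff_continuousAt]
  intro X
  obtain ⟨M, hM, H⟩ := exists_signature_lipschitz hp hT w X
  refine Metric.tendsto_nhds.2 fun η hη => ?_
  set ε := min 1 (η / (M + 1)) with hε
  have hε0 : 0 < ε := lt_min one_pos (by positivity)
  filter_upwards [Metric.eball_mem_nhds X (ENNReal.ofReal_pos.2 hε0)] with Y hY
  rw [Metric.mem_eball, edist_comm] at hY
  rw [Real.dist_eq]
  refine (H Y ε hε0 (min_le_left _ _) hY.le).trans_lt ?_
  have : ε * (M + 1) ≤ η := by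
    rw [← le_div_iff₀ (by positivity)]; exact min_le_right _ _
  nlinarith

end RoughPath

/-! ### Continuous functions with vanishing iterated integrals. -/

section IteratedIntegrals

/-- The iterated integrals from zero of a function. -/
def iteratedIntegral (g : ℝ → ℝ) : ℕ → ℝ → ℝ
  | 0 => g
  | k + 1 => fun t => ∫ r in (0 : ℝ)..t, iteratedIntegral g k r

variable {g : ℝ → ℝ} {T : ℝ}

theorem continuous_iteratedIntegral (hg : Continuous g) (k : ℕ) :
    Continuous (iteratedIntegral g k) := by
  induction k with
  | zero => exact hg
  | succ k ih => exact intervalIntegral.continuous_primitive (fun a b => ih.intervalIntegrable a b) 0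

theorem hasDerivAt_iteratedIntegral (hg : Continuous g) (k : ℕ) (t : ℝ) :
    HasDerivAt (iteratedIntegral g (k + 1)) (iteratedIntegral g k t) t :=
  (continuous_iteratedIntegral hg k).integral_hasStrictDerivAt 0 t |>.hasDerivAt

/-- Integration by parts differentiates the polynomial and raises k by one. The boundary terms
vanish, at T by hypothesis and at 0 by definition, so the induction on the degree must range over
all k. -/
theorem integral_polynomial_mul_eq_zero (hg : Continuous g)
    (h : ∀ k, iteratedIntegral g (k + 1) T = 0) (n : ℕ) :
    ∀ P : Polynomial ℝ, P.natDegree < n → ∀ k,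
      ∫ r in (0 : ℝ)..T, P.eval r * iteratedIntegral g k r = 0 := by
  induction n with
  | zero => intro P hP; omega
  | succ n ih =>
    intro P hP k
    have hparts := intervalIntegral.integral_mul_deriv_eq_deriv_mul (a := 0) (b := T)
      (u := fun r => P.eval r) (u' := fun r => P.derivative.eval r)
      (v := iteratedIntegral g (k + 1)) (v' := iteratedIntegral g k)
      (fun x _ => P.hasDerivAt x) (fun x _ => hasDerivAt_iteratedIntegral hg k x)
      (P.derivative.continuous.intervalIntegrable _ _)
      ((continuous_iteratedIntegral hg k).intervalIntegrable _ _)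
    have h0 : iteratedIntegral g (k + 1) 0 = 0 := by simp [iteratedIntegral]
    rw [hparts, h k, h0]
    rcases Nat.eq_zero_or_pos P.natDegree with hd | hd
    · rw [Polynomial.eq_C_of_natDegree_eq_zero hd]; simp
    · rw [ih _ ((Polynomial.natDegree_derivative_lt hd.ne').trans_le (by omega)) (k + 1)]
      simp

/-- A continuous function all of whose iterated integrals vanish at `T` is zero on `[0, T]`. -/
theorem eq_zero_of_iteratedIntegral_eq_zero (hT : 0 < T) (hg : Continuous g)
    (h : ∀ k, iteratedIntegral g (k + 1) T = 0) {t : ℝ} (ht : t ∈ Set.Icc 0 T) : g t = 0 := by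
  by_contra hne
  have hpos : 0 < ∫ r in (0 : ℝ)..T, g r * g r :=
    intervalIntegral.integral_pos hT (by fun_prop) (fun x _ => mul_self_nonneg _)
      ⟨t, ht, mul_self_pos.2 hne⟩
  obtain ⟨B, hB⟩ := (isCompact_Icc (a := (0 : ℝ)) (b := T)).exists_bound_of_continuousOn
    hg.continuousOn
  have hB0 : 0 ≤ B := (norm_nonneg _).trans (hB t ht)
  set A := ∫ r in (0 : ℝ)..T, g r * g r with hA
  -- The tolerance makes the integral of `(g - P) g` at most half of A, although orthogonality to P
  -- says that it equals A.
  obtain ⟨P, hP⟩ := exists_polynomial_near_of_continuousOn 0 T g hg.continuousOn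
    (A / (2 * (B * T + 1))) (by positivity)
  have h0 := integral_polynomial_mul_eq_zero hg h (P.natDegree + 1) P (by omega) 0
  have hdiff : A = ∫ r in (0 : ℝ)..T, (g r - P.eval r) * g r := by
    have e : ∀ r, (g r - P.eval r) * g r = g r * g r - P.eval r * iteratedIntegral g 0 r :=
      fun r => by simp only [iteratedIntegral]; ring
    simp only [e]
    rw [intervalIntegral.integral_sub, h0, sub_zero]
    · exact (hg.mul hg).intervalIntegrable _ _
    · exact (P.continuous.mul hg).intervalIntegrable _ _
  have hbound := intervalIntegral.norm_integral_le_of_norm_le_const (a := 0) (b := T)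
    (f := fun r => (g r - P.eval r) * g r) (C := A / (2 * (B * T + 1)) * B) fun r hr => by
      rw [Set.uIoc_of_le hT.le] at hr
      have hr' : r ∈ Set.Icc 0 T := ⟨hr.1.le, hr.2⟩
      rw [norm_mul]
      have h1 := (hP r hr').le
      rw [abs_sub_comm] at h1
      have h2 := hB r hr'
      rw [Real.norm_eq_abs (g r - _)]
      gcongr
  rw [← hdiff, Real.norm_eq_abs, abs_of_pos hpos, sub_zero, abs_of_pos hT] at hbound
  have : A / (2 * (B * T + 1)) * B * T = A * (B * T) / (2 * (B * T + 1)) := by ring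
  rw [this, le_div_iff₀ (by positivity)] at hbound
  have : 0 ≤ B * T := by positivity
  nlinarith

end IteratedIntegrals

/-! ### The signature determines a time-extended path. -/

section

variable {d : ℕ}

theorem tensorMul_append_singleton (x y : TensorSeries d) (w : List (Fin (d + 1)))
    (a : Fin (d + 1)) :
    tensorMul x y (w ++ [a]) = tensorMul x (fun v => y (v ++ [a])) w + x (w ++ [a]) * y [] := by
  simp only [tensorMul, List.length_append, List.length_singleton]
  rw [Finset.sum_range_succ]
  congr 1
  · refine Finset.sum_congr rfl fun k hk => ?_
    have hk' : k ≤ w.length := by have := Finset.mem_range.1 hk; omega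
    rw [List.take_append_of_le_length hk', List.drop_append_of_le_length hk']
  · rw [List.take_of_length_le (by simp), List.drop_of_length_le (by simp)]

/-- Only the splitting with empty left factor sees the coefficient of the right factor at `w`
itself. -/
theorem tensorMul_sub_of_eq_of_lt {x y y' : TensorSeries d} {w : List (Fin (d + 1))}
    (h : ∀ v, v.length < w.length → y v = y' v) :
    tensorMul x y w - tensorMul x y' w = x [] * (y w - y' w) := by
  rw [tensorMul, tensorMul, ← Finset.sum_sub_distrib, Finset.sum_range_succ', Finset.sum_eq_zero]
  · simp [mul_sub]
  · intro k hk
    have := Finset.mem_range.1 hk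
    rw [h _ (by simp; omega), sub_self]

end

namespace RoughPath

variable {d : ℕ} {p T : ℝ}

theorem IsExtension.continuousOn_right {X : RoughPath d p T} {S : ℝ → ℝ → TensorSeries d}
    (h : X.IsExtension S) {s : ℝ} (h0 : 0 ≤ s) (w : List (Fin (d + 1))) :
    ContinuousOn (fun r => S s r w) (Set.Icc s T) :=
  (h.continuousOn w).comp (f := fun r : ℝ => (s, r)) (by fun_prop)
    fun _ hr => ⟨h0, hr.1, hr.2⟩

theorem IsExtension.intervalIntegrable {X : RoughPath d p T} {S : ℝ → ℝ → TensorSeries d}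
    (h : X.IsExtension S) {s a b : ℝ} (h0 : 0 ≤ s) (h1 : s ≤ a) (h2 : a ≤ b) (h3 : b ≤ T)
    (w : List (Fin (d + 1))) :
    IntervalIntegrable (fun r => S s r w) MeasureTheory.volume a b := by
  refine ContinuousOn.intervalIntegrable ((h.continuousOn_right h0 w).mono ?_)
  rw [Set.uIcc_of_le h2]
  exact Set.Icc_subset_Icc h1 h3

/-- Iterated integrals of the extension that end in an integration in time are classical, in
every degree. -/
theorem IsTimeExtended.extension {X : RoughPath d p T} (hX : X.IsTimeExtended) (hp : 1 ≤ p)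
    {S : ℝ → ℝ → TensorSeries d} (hS : X.IsExtension S) (w : List (Fin (d + 1))) {s t : ℝ}
    (h0 : 0 ≤ s) (h1 : s ≤ t) (h2 : t ≤ T) :
    S s t (w ++ [0]) = ∫ r in s..t, S s r w := by
  induction hm : w.length using Nat.strong_induction_on generalizing w s t with
  | _ m ih =>
  rcases Nat.lt_or_ge ⌊p⌋₊ (w.length + 1) with hl | hl
  swap
  · rw [hS.agree s t ⟨h0, h1, h2⟩ _ (by simpa using hl), hX s t ⟨h0, h1, h2⟩ w hl]
    refine intervalIntegral.integral_congr fun r hr => ?_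
    rw [Set.uIcc_of_le h1] at hr
    exact (hS.agree s r ⟨h0, hr.1, hr.2.trans h2⟩ w (by omega)).symm
  -- For p ≥ 1 the words left over are nonempty. This matters: for the empty word the integrand is 1
  -- and does not vanish at the diagonal.
  have hp1 : 1 ≤ ⌊p⌋₊ := Nat.one_le_floor_iff p |>.2 hp
  have hne : w ≠ [] := by rw [← List.length_pos_iff]; omega
  have hP := hS.isPartialExtension (w.length + 1)
  refine sub_eq_zero.1 (eq_zero_of_additive_of_nearlyNull
    (Z := fun s t => S s t (w ++ [0]) - ∫ r in s..t, S s r w) ?_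
    (NearlyNull.sub (hP.nearlyNull hp (by simpa using hl) (by simp)) ?_) h0 h1 h2)
  -- Splitting off the last letter in Chen's relation and using the induction hypothesis for shorter
  -- words, both sides have the same defect, so their difference is additive.
  · intro a b c ha hab hbc hc
    have hb := ha.trans hab
    have hbT := hbc.trans hc
    have e1 : S a c (w ++ [0]) = tensorMul (S a b) (fun v => S b c (v ++ [0])) w
        + S a b (w ++ [0]) := by
      rw [hS.chen a b c ha hab hbc hc, tensorMul_append_singleton, hP.apply_nil hb hbc hc, mul_one]
    have e2 := tensorMul_sub_of_eq_of_lt (x := S a b) (y := fun v => S b c (v ++ [0]))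
      (y' := fun v => ∫ r in b..c, S b r v) (w := w)
      fun v hv => ih v.length (by omega) v hb hbc hc rfl
    rw [hP.apply_nil ha hab hbT, one_mul] at e2
    have e3 : tensorMul (S a b) (fun v => ∫ r in b..c, S b r v) w = ∫ r in b..c, S a r w := by
      have : ∫ r in b..c, S a r w = ∫ r in b..c, tensorMul (S a b) (S b r) w := by
        refine intervalIntegral.integral_congr fun r hr => ?_
        rw [Set.uIcc_of_le hbc] at hr
        rw [← hS.chen a b r ha hab hr.1 (hr.2.trans hc)]
      rw [this]
      simp only [tensorMul]
      rw [intervalIntegral.integral_finsetSum fun k _ =>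
        (hS.intervalIntegrable hb le_rfl hbc hc _).const_mul _]
      simp only [intervalIntegral.integral_const_mul]
    have e4 := intervalIntegral.integral_add_adjacent_intervals
      (hS.intervalIntegrable ha le_rfl hab hbT w) (hS.intervalIntegrable ha hab hbc hc w)
    linarith
  -- The integral over a short interval is its length times a small bound on the integrand.
  · refine ⟨_, IsControl.length, fun η hη => ?_⟩
    obtain ⟨δ, hδ, D⟩ := hP.vanishesAtDiagonal hne (by omega) η hη
    refine ⟨δ, hδ, fun a b ha hab hb hd => ?_⟩
    have := intervalIntegral.norm_integral_le_of_norm_le_const (a := a) (b := b)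
      (f := fun r => S a r w) (C := η) fun r hr => by
        rw [Set.uIoc_of_le hab] at hr
        exact D a r ha hr.1.le (hr.2.trans hb) (by linarith [hr.2])
    rwa [abs_of_nonneg (sub_nonneg.2 hab)] at this

theorem IsTimeExtended.iteratedIntegral_eq {X Y : RoughPath d p T} (hX : X.IsTimeExtended)
    (hY : Y.IsTimeExtended) (hp : 1 ≤ p) {S S' : ℝ → ℝ → TensorSeries d} (hS : X.IsExtension S)
    (hS' : Y.IsExtension S') (w : List (Fin (d + 1))) {g : ℝ → ℝ}
    (hg : ∀ t ∈ Set.Icc 0 T, g t = S 0 t w - S' 0 t w) (k : ℕ) :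
    ∀ t ∈ Set.Icc 0 T, iteratedIntegral g k t
      = S 0 t (w ++ List.replicate k 0) - S' 0 t (w ++ List.replicate k 0) := by
  induction k with
  | zero => simpa [iteratedIntegral] using hg
  | succ k ih =>
    intro t ht
    rw [List.replicate_succ', ← List.append_assoc, hX.extension hp hS _ le_rfl ht.1 ht.2,
      hY.extension hp hS' _ le_rfl ht.1 ht.2, ← intervalIntegral.integral_sub
      (hS.intervalIntegrable le_rfl le_rfl ht.1 ht.2 _)
      (hS'.intervalIntegrable le_rfl le_rfl ht.1 ht.2 _)]
    refine intervalIntegral.integral_congr fun r hr => ?_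
    rw [Set.uIcc_of_le ht.1] at hr
    exact ih r ⟨hr.1, hr.2.trans ht.2⟩

/-- The signature determines a time-extended rough path. -/
theorem IsTimeExtended.eq_of_signature_eq {X Y : RoughPath d p T} (hX : X.IsTimeExtended)
    (hY : Y.IsTimeExtended) (hp : 1 ≤ p) (hT : 0 < T) (h : X.signature = Y.signature) :
    X = Y := by
  obtain ⟨S, hS⟩ := X.exists_isExtension hp
  obtain ⟨S', hS'⟩ := Y.exists_isExtension hp
  rw [hS.signature_eq hp hT.le, hS'.signature_eq hp hT.le] at h
  have hbase : ∀ w, ∀ t ∈ Set.Icc 0 T, S 0 t w = S' 0 t w := by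
    intro w t ht
    have hc : ContinuousOn (fun t => S 0 t w - S' 0 t w) (Set.Icc 0 T) :=
      (hS.continuousOn_right le_rfl w).sub (hS'.continuousOn_right le_rfl w)
    -- Constant extension outside `[0, T]` makes g continuous on the line.
    set g : ℝ → ℝ := Set.IccExtend hT.le ((Set.Icc 0 T).domRestrict fun t => S 0 t w - S' 0 t w)
    have hg : ∀ t ∈ Set.Icc 0 T, g t = S 0 t w - S' 0 t w := fun t ht =>
      Set.IccExtend_of_mem hT.le _ ht
    have hgc : Continuous g := hc.domRestrict.Icc_extend'
    have := eq_zero_of_iteratedIntegral_eq_zero hT hgc (fun k => by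
      rw [hX.iteratedIntegral_eq hY hp hS hS' w hg (k + 1) T ⟨hT.le, le_rfl⟩, h, sub_self]) ht
    rw [hg t ht] at this
    linarith
  -- Chen's relation between 0, s and t determines the values on `[s, t]` from those started at 0.
  have hall : ∀ (w : List (Fin (d + 1))) s t, 0 ≤ s → s ≤ t → t ≤ T → S s t w = S' s t w := by
    intro w s t h0 h1 h2
    induction hm : w.length using Nat.strong_induction_on generalizing w with
    | _ m ih =>
    have hP := hS.isPartialExtension w.length
    have hP' := hS'.isPartialExtension w.length
    rcases eq_or_ne w [] with rfl | hne
    · rw [hP.apply_nil h0 h1 h2, hP'.apply_nil h0 h1 h2]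
    have e := hP.chen_splitSum le_rfl h0 h1 h2 hne le_rfl
    have e' := hP'.chen_splitSum le_rfl h0 h1 h2 hne le_rfl
    rw [splitSum_congr (x' := S' 0 s) (y' := S' s t) (fun v _ => hbase v s ⟨h0, h1.trans h2⟩)
      (fun v hv => ih v.length (by omega) v rfl), hbase w t ⟨h0.trans h1, h2⟩,
      hbase w s ⟨h0, h1.trans h2⟩] at e
    linarith
  ext s t w
  by_cases hw : (s, t) ∈ timeSimplex T ∧ w.length ≤ ⌊p⌋₊
  · rw [← hS.agree s t hw.1 w hw.2, ← hS'.agree s t hw.1 w hw.2]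
    exact hall w s t hw.1.1 hw.1.2.1 hw.1.2.2
  · rw [X.zero_off s t w hw, Y.zero_off s t w hw]

end RoughPath

/-! ### Approximation by a separating algebra on a tight space. -/

section TightApproximation

open MeasureTheory

variable {V : Type*} [TopologicalSpace V] [TopologicalSpace.MetrizableSpace V]
  [MeasurableSpace V] [BorelSpace V] {μ : Measure V} [IsProbabilityMeasure μ]

/-- A finite Borel measure on a metrizable space is inner regular for closed sets; intersecting
first with a compact set of almost full measure makes the closed set compact, with no completeness
of `V`. -/
theorem exists_isCompact_subset_of_tight
    (htight : ∀ δ : ℝ, 0 < δ → ∃ K : Set V, IsCompact K ∧ 1 - δ ≤ μ.real K) {G : Set V}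
    (hG : MeasurableSet G) {η : ℝ} (hη : 0 < η) :
    ∃ K ⊆ G, IsCompact K ∧ μ.real G - η ≤ μ.real K := by
  obtain ⟨K₀, hK₀, hm⟩ := htight (η / 2) (by positivity)
  have hK₀m := hK₀.isClosed.measurableSet
  obtain ⟨K, hKs, hKc, hK⟩ := (hG.inter hK₀m).exists_isClosed_sdiff_lt (μ := μ)
    (measure_ne_top _ _) (ε := ENNReal.ofReal (η / 2)) (by simpa using hη)
  refine ⟨K, hKs.trans Set.inter_subset_left,
    hK₀.of_isClosed_subset hKc (hKs.trans Set.inter_subset_right), ?_⟩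
  have e1 : μ.real ((G ∩ K₀) \ K) ≤ η / 2 := by
    have := ENNReal.toReal_mono ENNReal.ofReal_ne_top hK.le
    rwa [ENNReal.toReal_ofReal (by positivity)] at this
  have e2 : μ.real G ≤ μ.real (((G ∩ K₀) \ K) ∪ K ∪ K₀ᶜ) := by
    refine measureReal_mono fun x hx => ?_
    by_cases h1 : x ∈ K₀ <;> by_cases h2 : x ∈ K <;> simp [h1, h2, hx]
  have e3 := measureReal_union_le (μ := μ) (((G ∩ K₀) \ K) ∪ K) K₀ᶜ
  have e4 := measureReal_union_le (μ := μ) ((G ∩ K₀) \ K) K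
  have e5 := probReal_compl_eq_one_sub (μ := μ) hK₀m
  linarith

/-- If a compact set does not carry the whole measure, an algebra of integrable functions that
separates points contains functions with prescribed integral that are small on that set. -/
theorem exists_mem_small_with_integral
    (htight : ∀ δ : ℝ, 0 < δ → ∃ K : Set V, IsCompact K ∧ 1 - δ ≤ μ.real K)
    {A : Subalgebra ℝ C(V, ℝ)} (hA : A.SeparatesPoints)
    (hint : ∀ R ∈ A, Integrable (fun x => R x) μ) {K : Set V} (hK : IsCompact K)
    (hμK : 0 < μ.real Kᶜ) {η : ℝ} (hη : 0 < η) (v : ℝ) :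
    ∃ R ∈ A, (∀ x ∈ K, |R x| < η) ∧ ∫ x, R x ∂μ = v := by
  obtain ⟨C, hCs, hC, hCμ⟩ := exists_isCompact_subset_of_tight htight
    hK.isClosed.measurableSet.compl (half_pos hμK)
  have hδ : 0 < μ.real C := by linarith
  let _ := TopologicalSpace.metrizableSpaceMetric V
  obtain ⟨f, hf0, hf1, -⟩ := exists_continuous_zero_one_of_isClosed hK.isClosed hC.isClosed
    (Set.disjoint_right.2 fun x hx => hCs hx)
  -- Approximating twice the Urysohn function within 1/2 gives an element at most 1/2 on `K` and at
  -- least 1 on `C`. Off `K ∪ C` it is uncontrolled, so even powers are used below to prevent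
  -- cancellation.
  obtain ⟨H, hHA, hH⟩ :=
    ContinuousMap.exists_mem_subalgebra_near_continuous_of_isCompact_of_separatesPoints hA
      ((2 : ℝ) • f) (hK.union hC) (show (0 : ℝ) < 1 / 2 by norm_num)
  have hHK : ∀ x ∈ K, |H x| ≤ 1 / 2 := fun x hx => by
    have := hH x (Or.inl hx)
    simp only [ContinuousMap.smul_apply, hf0 hx, Pi.zero_apply, smul_zero, sub_zero,
      Real.norm_eq_abs] at this
    exact this.le
  have hHC : ∀ x ∈ C, 1 ≤ |H x| := fun x hx => by
    have := hH x (Or.inr hx)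
    simp only [ContinuousMap.smul_apply, hf1 hx, Pi.one_apply, smul_eq_mul, mul_one,
      Real.norm_eq_abs] at this
    have h2 := (abs_lt.1 this).1
    refine le_trans ?_ (le_abs_self _)
    linarith
  obtain ⟨k, hk⟩ : ∃ k : ℕ, |v| / μ.real C * (1 / 4 : ℝ) ^ k < η := by
    have := (tendsto_pow_atTop_nhds_zero_of_lt_one (r := (1 / 4 : ℝ)) (by norm_num)
      (by norm_num)).const_mul (|v| / μ.real C)
    rw [mul_zero] at this
    exact (this.eventually (gt_mem_nhds hη)).exists
  have hpow : ∀ x, (H ^ (2 * k)) x = (|H x| ^ 2) ^ k := fun x => by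
    rw [ContinuousMap.pow_apply, pow_mul, sq_abs]
  have hHkA : H ^ (2 * k) ∈ A := pow_mem hHA _
  have hI : μ.real C ≤ ∫ x, (H ^ (2 * k)) x ∂μ := by
    have h1 := setIntegral_mono_on (μ := μ) (s := C) (f := fun _ => (1 : ℝ))
      (g := fun x => (H ^ (2 * k)) x) (integrableOn_const (measure_ne_top _ _))
      (hint _ hHkA).integrableOn hC.isClosed.measurableSet fun x hx => by
        rw [hpow]
        exact one_le_pow₀ (one_le_pow₀ (hHC x hx))
    have h2 := setIntegral_le_integral (s := C) (hint _ hHkA)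
      (Filter.Eventually.of_forall fun x => (by positivity : (0 : ℝ) ≤ (|H x| ^ 2) ^ k).trans_eq
        (hpow x).symm)
    simp only [setIntegral_const, smul_eq_mul, mul_one] at h1
    exact h1.trans h2
  set J := ∫ x, (H ^ (2 * k)) x ∂μ
  have hJ : 0 < J := hδ.trans_le hI
  refine ⟨(v / J) • H ^ (2 * k), A.smul_mem hHkA _, fun x hx => ?_, ?_⟩
  · rw [ContinuousMap.smul_apply, smul_eq_mul, abs_mul, hpow, abs_div, abs_of_pos hJ,
      abs_of_nonneg (show 0 ≤ (|H x| ^ 2) ^ k by positivity)]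
    refine lt_of_le_of_lt ?_ hk
    gcongr
    have := hHK x hx
    calc |H x| ^ 2 ≤ (1 / 2) ^ 2 := by gcongr
      _ = 1 / 4 := by norm_num
  · simp only [ContinuousMap.smul_apply, smul_eq_mul]
    rw [integral_const_mul]
    exact div_mul_cancel₀ v hJ.ne'

/-- An integrable function on a tight probability space is approximated by a separating algebra
of integrable continuous functions, uniformly on a large compact set and in expectation. -/
theorem exists_mem_subalgebra_near_of_tight
    (htight : ∀ δ : ℝ, 0 < δ → ∃ K : Set V, IsCompact K ∧ 1 - δ ≤ μ.real K)
    {A : Subalgebra ℝ C(V, ℝ)} (hA : A.SeparatesPoints)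
    (hint : ∀ R ∈ A, Integrable (fun x => R x) μ) {F : V → ℝ} (hF : Measurable F)
    (hFi : Integrable F μ) {ε : ℝ} (hε : 0 < ε) :
    ∃ R ∈ A, ∃ K : Set V, IsCompact K ∧ 1 - ε ≤ μ.real K ∧ (∀ x ∈ K, |F x - R x| < ε) ∧
      |∫ x, F x ∂μ - ∫ x, R x ∂μ| < ε := by
  -- By Markov's inequality at level ε/4, the error ε²/8 leaves an exceptional set of measure at
  -- most ε/2.
  obtain ⟨f, hf, hfi⟩ := hFi.exists_boundedContinuous_integral_sub_le
    (ε := ε ^ 2 / 8) (by positivity)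
  set B := {x | ε / 4 ≤ ‖F x - f x‖} with hB
  have hBm : MeasurableSet B :=
    measurableSet_le measurable_const (hF.sub f.continuous.measurable).norm
  have hBμ : μ.real B ≤ ε / 2 := by
    have h1 := (mul_meas_ge_le_integral_of_nonneg
      (Filter.Eventually.of_forall fun x => norm_nonneg _) (hFi.sub hfi).norm (ε / 4)).trans hf
    have h2 : ε / 4 * μ.real B ≤ ε / 4 * (ε / 2) := by
      calc _ ≤ ε ^ 2 / 8 := h1
        _ = _ := by ring
    exact le_of_mul_le_mul_left h2 (by positivity)
  obtain ⟨K, hKs, hK, hKμ⟩ := exists_isCompact_subset_of_tight htight hBm.compl (half_pos hε)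
  rw [probReal_compl_eq_one_sub hBm] at hKμ
  have hFf : ∀ x ∈ K, |F x - f x| < ε / 4 := fun x hx => not_le.1 (hKs hx)
  obtain ⟨R, hRA, hR⟩ :=
    ContinuousMap.exists_mem_subalgebra_near_continuous_of_isCompact_of_separatesPoints hA
      f.toContinuousMap hK (show 0 < ε / 4 by positivity)
  have hFR : ∀ x ∈ K, |F x - R x| < ε / 2 := fun x hx => by
    have h1 := hFf x hx
    have h2 : |R x - f x| < ε / 4 := hR x hx
    rw [abs_lt] at *
    constructor <;> linarith
  have hKε : 1 - ε ≤ μ.real K := by linarith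
  -- If `Kᶜ` is null, uniform closeness on `K` already controls the expectation. Otherwise there is
  -- room outside `K` for a correction making the expectations equal.
  rcases (measureReal_nonneg (μ := μ) (s := Kᶜ)).eq_or_lt with h0 | h0
  · refine ⟨R, hRA, K, hK, hKε, fun x hx => (hFR x hx).trans (half_lt_self hε), ?_⟩
    have hae : ∀ᵐ x ∂μ, ‖F x - R x‖ ≤ ε / 2 := by
      have : μ Kᶜ = 0 := by
        rwa [eq_comm, measureReal_eq_zero_iff] at h0
      filter_upwards [compl_mem_ae_iff.2 this] with x hx
      rw [compl_compl] at hx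
      exact (hFR x hx).le
    rw [← integral_sub hFi (hint R hRA)]
    have := norm_integral_le_of_norm_le_const hae
    rw [probReal_univ, mul_one] at this
    exact lt_of_le_of_lt this (half_lt_self hε)
  · obtain ⟨H, hHA, hHK, hHI⟩ := exists_mem_small_with_integral htight hA hint hK h0
      (half_pos hε) (∫ x, F x ∂μ - ∫ x, R x ∂μ)
    refine ⟨R + H, add_mem hRA hHA, K, hK, hKε, fun x hx => ?_, ?_⟩
    · have h1 := hFR x hx
      have h2 := hHK x hx
      rw [ContinuousMap.add_apply]
      rw [abs_lt] at *
      constructor <;> linarith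
    · simp only [ContinuousMap.add_apply]
      rw [integral_add (hint R hRA) (hint H hHA), hHI]
      simpa using hε

end TightApproximation

/-! ### The algebra of signature polynomials. -/

namespace TimeExtendedRoughPath

open MeasureTheory

variable {d : ℕ} {p T : ℝ}

/-- A coefficient of the signature, as a continuous function of the rough path. -/
def signatureCoord (hp : 1 ≤ p) (hT : 0 < T) (w : List (Fin (d + 1))) :
    C(TimeExtendedRoughPath d p T, ℝ) where
  toFun X := X.1.signature w
  continuous_toFun := (RoughPath.continuous_signature hp hT.le w).comp
    (continuous_subtype_val (p := fun X : RoughPath d p T => X.IsTimeExtended))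

/-- The algebra of signature polynomials. -/
def signatureAlgebra (d : ℕ) (hp : 1 ≤ p) (hT : 0 < T) :
    Subalgebra ℝ C(TimeExtendedRoughPath d p T, ℝ) :=
  Algebra.adjoin ℝ (Set.range (signatureCoord hp hT))

theorem signatureAlgebra_separatesPoints (hp : 1 ≤ p) (hT : 0 < T) :
    (signatureAlgebra d hp hT).SeparatesPoints := by
  intro X Y hXY
  have hne : X.1.signature ≠ Y.1.signature := fun h =>
    hXY (Subtype.ext (X.2.eq_of_signature_eq Y.2 hp hT h))
  obtain ⟨w, hw⟩ := Function.ne_iff.1 hne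
  exact ⟨_, ⟨_, Algebra.subset_adjoin ⟨w, rfl⟩, rfl⟩, hw⟩

/-- Polynomial growth holds for coefficients and survives sums and products; with finite moments it
yields integrability of the whole algebra. -/
theorem exists_growth_of_mem_signatureAlgebra (hp : 1 ≤ p) (hT : 0 < T)
    {R : C(TimeExtendedRoughPath d p T, ℝ)} (hR : R ∈ signatureAlgebra d hp hT) :
    ∃ (C : ℝ) (N : ℕ), 0 ≤ C ∧ ∀ X, |R X| ≤ C * (1 + X.1.pVariation) ^ N := by
  have hone : ∀ X : TimeExtendedRoughPath d p T, 1 ≤ 1 + X.1.pVariation := fun X => by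
    have := X.1.pVariation_nonneg
    linarith
  induction hR using Algebra.adjoin_induction with
  | mem R hR =>
    obtain ⟨w, rfl⟩ := hR
    obtain ⟨C, hC, H⟩ := RoughPath.exists_signature_growth (d := d) hp hT.le w
    exact ⟨C, w.length, hC, fun X => H X.1⟩
  | algebraMap r => exact ⟨|r|, 0, abs_nonneg r, fun X => by simp⟩
  | add R R' _ _ h h' =>
    obtain ⟨C, N, hC, H⟩ := h
    obtain ⟨C', N', hC', H'⟩ := h'
    refine ⟨C + C', max N N', by positivity, fun X => ?_⟩
    have e := hone X
    calc |(R + R') X| ≤ |R X| + |R' X| := abs_add_le _ _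
      _ ≤ C * (1 + X.1.pVariation) ^ max N N' + C' * (1 + X.1.pVariation) ^ max N N' := by
        refine add_le_add ((H X).trans ?_) ((H' X).trans ?_)
        · exact mul_le_mul_of_nonneg_left (pow_le_pow_right₀ e (le_max_left _ _)) hC
        · exact mul_le_mul_of_nonneg_left (pow_le_pow_right₀ e (le_max_right _ _)) hC'
      _ = _ := by ring
  | mul R R' _ _ h h' =>
    obtain ⟨C, N, hC, H⟩ := h
    obtain ⟨C', N', hC', H'⟩ := h'
    refine ⟨C * C', N + N', by positivity, fun X => ?_⟩
    have e := hone X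
    calc |(R * R') X| = |R X| * |R' X| := abs_mul _ _
      _ ≤ (C * (1 + X.1.pVariation) ^ N) * (C' * (1 + X.1.pVariation) ^ N') :=
        mul_le_mul (H X) (H' X) (abs_nonneg _) (by positivity)
      _ = _ := by ring

theorem integrable_of_mem_signatureAlgebra (hp : 1 ≤ p) (hT : 0 < T) {Ω : Type*}
    [MeasurableSpace Ω] {P : Measure Ω} {X : Ω → TimeExtendedRoughPath d p T}
    (hX : Measurable X) (hmoments : ∀ k : ℕ, Integrable (fun ω => (X ω).1.pVariation ^ k) P)
    {R : C(TimeExtendedRoughPath d p T, ℝ)} (hR : R ∈ signatureAlgebra d hp hT) :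
    Integrable (fun ω => R (X ω)) P := by
  obtain ⟨C, N, hC, H⟩ := exists_growth_of_mem_signatureAlgebra hp hT hR
  have hdom : Integrable (fun ω => C * (1 + (X ω).1.pVariation) ^ N) P := by
    refine Integrable.const_mul ?_ C
    simp only [add_comm (1 : ℝ), add_pow, one_pow, mul_one]
    exact integrable_finsetSum _ fun k _ => (hmoments k).mul_const _
  refine hdom.mono' (R.continuous.measurable.comp hX).aestronglyMeasurable
    (Filter.Eventually.of_forall fun ω => ?_)
  exact H (X ω)

theorem signatureMonomial_single {n : ℕ} (f : Fin n → List (Fin (d + 1))) (m : Fin n → ℕ)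
    (X : TimeExtendedRoughPath d p T) :
    signatureMonomial (fun i => Finsupp.single (f i) 1) m X
      = ∏ i, X.1.signature (f i) ^ m i := by
  simp [signatureMonomial, pairing]

theorem prod_signatureCoord_mem (hp : 1 ≤ p) (hT : 0 < T) {n : ℕ}
    (f : Fin n → List (Fin (d + 1))) (m : Fin n → ℕ) :
    ∏ i, signatureCoord hp hT (f i) ^ m i ∈ signatureAlgebra d hp hT :=
  prod_mem fun i _ => pow_mem
    (Algebra.subset_adjoin (Set.mem_range_self (f := signatureCoord hp hT) (f i))) _

theorem prod_signatureCoord_apply (hp : 1 ≤ p) (hT : 0 < T) {n : ℕ}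
    (f : Fin n → List (Fin (d + 1))) (m : Fin n → ℕ) (X : TimeExtendedRoughPath d p T) :
    (∏ i, signatureCoord hp hT (f i) ^ m i) X
      = signatureMonomial (fun i => Finsupp.single (f i) 1) m X := by
  rw [signatureMonomial_single, ContinuousMap.prod_apply]
  rfl

/-- The elements of the algebra are the polynomials in finitely many coefficients. -/
theorem exists_eq_sum_signatureMonomial (hp : 1 ≤ p) (hT : 0 < T)
    {R : C(TimeExtendedRoughPath d p T, ℝ)} (hR : R ∈ signatureAlgebra d hp hT) :
    ∃ (n : ℕ) (f : Fin n → List (Fin (d + 1))) (𝒩 : Finset (Fin n → ℕ)) (α : (Fin n → ℕ) → ℝ),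
      ∀ X, R X = ∑ m ∈ 𝒩, α m * signatureMonomial (fun i => Finsupp.single (f i) 1) m X := by
  classical
  rw [signatureAlgebra, Algebra.adjoin_range_eq_range_aeval] at hR
  obtain ⟨Q, rfl⟩ := hR
  -- A polynomial in coefficients indexed by all words involves only finitely many words.
  obtain ⟨n, f, -, q, rfl⟩ := MvPolynomial.exists_fin_rename Q
  refine ⟨n, f, q.support.image fun m : Fin n →₀ ℕ => ⇑m,
    fun m => q.coeff (Finsupp.equivFunOnFinite.symm m), fun X => ?_⟩
  rw [Finset.sum_image fun a _ b _ h => DFunLike.coe_injective h]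
  have hc : ∀ m : Fin n →₀ ℕ, Finsupp.equivFunOnFinite.symm (⇑m) = m := fun m =>
    Finsupp.equivFunOnFinite.symm_apply_apply m
  simp only [hc]
  change MvPolynomial.aeval (signatureCoord hp hT) (MvPolynomial.rename f q) X = _
  rw [MvPolynomial.aeval_rename, MvPolynomial.aeval_def, MvPolynomial.eval₂_eq',
    ContinuousMap.sum_apply]
  refine Finset.sum_congr rfl fun m _ => ?_
  rw [ContinuousMap.mul_apply, ← prod_signatureCoord_apply hp hT]
  rfl

end TimeExtendedRoughPath

end

/-! ### The main theorem, by transfer to the law of the random path. -/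

theorem theorem5p1 (d : ℕ) (p T : ℝ) (hp : 1 ≤ p) (hT : 0 < T)
    {Ω : Type*} [MeasurableSpace Ω] (P : MeasureTheory.Measure Ω)
    [MeasureTheory.IsProbabilityMeasure P]
    -- the random price path: Borel measurable and tight
    (X : Ω → TimeExtendedRoughPath d p T) (hX : Measurable X)
    (htight : ∀ δ : ℝ, 0 < δ → ∃ K : Set (TimeExtendedRoughPath d p T),
      IsCompact K ∧ 1 - δ ≤ P.real {ω | X ω ∈ K})
    -- the price path has finite moments
    (hmoments : ∀ k : ℕ, MeasureTheory.Integrable (fun ω => (X ω).1.pVariation ^ k) P)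
    -- the payoff functional, with a finite moment of some order `q ≥ 1`
    (F : TimeExtendedRoughPath d p T → ℝ) (hF : Measurable F)
    (q : ℝ) (hq : 1 ≤ q)
    (hFq : MeasureTheory.Integrable (fun ω => |F (X ω)| ^ q) P)
    (ε : ℝ) (hε : 0 < ε) :
    ∃ (n : ℕ) (π : Fin n → WeightedWord d) (𝒩 : Finset (Fin n → ℕ)) (α : (Fin n → ℕ) → ℝ)
      (K : Set (TimeExtendedRoughPath d p T)),
      -- the correlators that occur are finite
      (∀ m ∈ 𝒩, MeasureTheory.Integrable
        (fun ω => TimeExtendedRoughPath.signatureMonomial π m (X ω)) P) ∧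
      -- the signature polynomial approximates the payoff uniformly on a large compact set
      IsCompact K ∧ 1 - ε ≤ P.real {ω | X ω ∈ K} ∧
      (∀ x ∈ K, |F x - ∑ m ∈ 𝒩, α m * TimeExtendedRoughPath.signatureMonomial π m x| < ε) ∧
      -- its expectation, a combination of correlators, approximates the price
      |(∫ ω, F (X ω) ∂P)
        - ∑ m ∈ 𝒩, α m * TimeExtendedRoughPath.correlator P X π m| < ε := by
  have hmap : ∀ K : Set (TimeExtendedRoughPath d p T), IsCompact K →
      (P.map X).real K = P.real {ω | X ω ∈ K} := fun K hK =>
    MeasureTheory.map_measureReal_apply hX hK.isClosed.measurableSet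
  have := MeasureTheory.Measure.isProbabilityMeasure_map (μ := P) hX.aemeasurable
  -- For q ≥ 1, `|F| ≤ 1 + |F| ^ q`.
  have hFX : MeasureTheory.Integrable (fun ω => F (X ω)) P := by
    refine ((MeasureTheory.integrable_const (1 : ℝ)).add hFq).mono'
      (hF.comp hX).aestronglyMeasurable (Filter.Eventually.of_forall fun ω => ?_)
    rw [Pi.add_apply, Real.norm_eq_abs]
    have hpos : 0 ≤ |F (X ω)| ^ q := by positivity
    rcases le_total |F (X ω)| 1 with h | h
    · linarith
    · have := Real.rpow_le_rpow_of_exponent_le h hq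
      rw [Real.rpow_one] at this
      linarith
  have hint : ∀ R ∈ TimeExtendedRoughPath.signatureAlgebra d hp hT,
      MeasureTheory.Integrable (fun ω => R (X ω)) P := fun R hR =>
    TimeExtendedRoughPath.integrable_of_mem_signatureAlgebra hp hT hX hmoments hR
  obtain ⟨R, hR, K, hK, hKμ, hRK, hRE⟩ := exists_mem_subalgebra_near_of_tight (μ := P.map X)
    (fun δ hδ => by
      obtain ⟨K, hK, h⟩ := htight δ hδ
      exact ⟨K, hK, by rwa [hmap K hK]⟩)
    (TimeExtendedRoughPath.signatureAlgebra_separatesPoints hp hT)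
    (fun R hR => (MeasureTheory.integrable_map_measure
      R.continuous.measurable.aestronglyMeasurable hX.aemeasurable).2 (hint R hR)) hF
    ((MeasureTheory.integrable_map_measure hF.aestronglyMeasurable hX.aemeasurable).2 hFX) hε
  rw [MeasureTheory.integral_map hX.aemeasurable hF.aestronglyMeasurable,
    MeasureTheory.integral_map hX.aemeasurable
      R.continuous.measurable.aestronglyMeasurable] at hRE
  obtain ⟨n, f, 𝒩, α, hsum⟩ := TimeExtendedRoughPath.exists_eq_sum_signatureMonomial hp hT hR
  have hmon : ∀ m : Fin n → ℕ, MeasureTheory.Integrable (fun ω =>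
      TimeExtendedRoughPath.signatureMonomial (fun i => Finsupp.single (f i) 1) m (X ω)) P := by
    intro m
    have := hint _ (TimeExtendedRoughPath.prod_signatureCoord_mem hp hT f m)
    simpa only [TimeExtendedRoughPath.prod_signatureCoord_apply] using this
  -- Single words suffice as the weighted words.
  refine ⟨n, fun i => Finsupp.single (f i) 1, 𝒩, α, K, fun m _ => hmon m, hK,
    by rwa [← hmap K hK], fun x hx => ?_, ?_⟩
  · rw [← hsum x]
    exact hRK x hx
  · simp only [hsum] at hRE
    rw [MeasureTheory.integral_finsetSum _ fun m _ => (hmon m).const_mul _] at hRE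
    simpa only [MeasureTheory.integral_const_mul, TimeExtendedRoughPath.correlator] using hRE
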